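/- **Splice diagrams.** A (rooted) splice diagram is a finite tree with some vertices marked as arrowheads and one vertex marked as the root. The other vertices are leaves (valency $1$, no adjacent weights) and nodes (valency $\ge 2$); at each node, and at the root, every adjacent edge carries an integer weight, and the weights at the root are all $1$. *Reduction 1* deletes a leaf together with its edge if the weight at the other end of the edge is $1$. *Reduction 2* removes a non-root node of valency $2$ and coalesces its two edges, keeping the weights at the outer ends. A diagram is *reduced* if no reduction applies. Unrooted diagrams have no root. **Diagram of a polynomial.** Let $f\in\mathbb C[x,y]$ be non-constant of degree $N$ with top-degree homogeneous part $f_N$; $[a{:}b]$ is a *point at infinity* of $f$ if $f_N(a,b)=0$. For $c\in\mathbb C$ and a point $P$ on the line at infinity, choose linear coordinates in which $P=[1{:}0]$, and let $S_P$ be the finite set of all Puiseux series $s=\sum_{r<1}a_rx^r$ (decreasing rational exponents with a common denominator) for which $y=s$ solves $f=c$ in these coordinates. Two series are conjugate if one arises from the other by $x^{1/n}\mapsto\zeta x^{1/n}$ with $\zeta^n=1$; the conjugacy classes in $S_P$ are the branches of $f=c$ at $P$. For a series with exponents $r_1>r_2>\dots$ write its Newton form $x^{q_1/p_1}(a_1+x^{d_1/(p_1p_2)}(a_2+x^{d_2/(p_1p_2p_3)}(a_3+\cdots)))$,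 where $p_1\cdots p_i$ is the least common denominator of $r_1,\dots,r_i$, and define $q_{i+1}=d_i+q_ip_ip_{i+1}$. Build a diagram as follows. The arrowheads are the branches at all $P$. For each $P$ there is a node for each exponent $r$ and each class, up to conjugation, of initial segments (the terms with exponents $>r$) such that at least two elements of $S_P$ have that same initial segment and at least one of them has a non-zero coefficient at $x^r$. The path from the root to an arrowhead passes through the nodes given by the initial segments of the expansions of that branch, in order of decreasing $r$. Let $q,p$ be the last of the numbers $q_i,p_i$ computed for the exponents of the initial segment followed by $r$. The node has weight $q$ on the edge towards the root, weight $p$ on the edge in the direction of the expansions with coefficient $0$ at $x^r$ (an edge to an extra leaf if there are none), and weight $1$ on its other edges. Reducing this diagram gives the reduced rooted splice diagram of $f^{-1}(c)$ (for reduced fibres). It is the same up to isomorphism for all but finitely many $c$, and this common diagram is the *(regular) reduced rooted splice diagram of $f$*. **Minimality.** The *reduced unrooted diagram* of a reduced rooted diagram is obtained by changing the root to an ordinary vertex and reducing. The *exceptional* rooted diagrams, for integers $p\ge q\ge1$ with $\gcd(p,q)=1$ and $pd>1$, are the reductions of the following diagram: the root is joined to two nodes; the first has weight $-q$ towards the root,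 an edge of weight $p$ to a leaf, and $d$ arrowheads (weights $1$); the second has weight $-p$ towards the root, an edge of weight $q$ to a leaf, and $d$ arrowheads (weights $1$). A reduced rooted diagram is *minimal* if it is exceptional, or if it results from its reduced unrooted diagram by placing a root vertex at an existing (non-arrowhead) vertex or on an existing edge. **Proposition.** Let $f\in\mathbb C[x,y]$ be non-constant and suppose that $[1{:}0]$ is a point at infinity of $f$. If the regular reduced rooted splice diagram of $f$ is not minimal, then there are $c\in\mathbb C$ and an integer $q>1$ such that the triangular automorphism $(x,y)\mapsto(x-cy^q,y)$ strictly lowers the degree: $\deg f(x-cy^q,y)<\deg f(x,y)$. -/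

import Mathlib

/-! ### Decorated graphs, reductions, rooting -/

/-- The data of a splice diagram: a graph, some of whose vertices are arrowheads, at most one of
whose vertices is the root (there is none in an unrooted diagram), with an integer `weight u v` at
the `u`-end of the edge from `u` to `v`. Arrowheads and leaves carry no weights: the values
of `weight u v` for such `u`, and for non-adjacent `u`, `v`, are never used. The diagrams attached
to polynomials below are finite trees. -/
structure SpliceDiagram where
  V : Type
  graph : SimpleGraph V
  isArrow : V → Prop
  isRoot : V → Prop
  weight : V → V → ℤ

namespace SpliceDiagram

/-- The number of edges at a vertex. -/
noncomputable def valency (D : SpliceDiagram) (v : D.V) : ℕ :=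
  (D.graph.neighborSet v).ncard

/-- A leaf: a vertex of valency one that is neither an arrowhead nor the root. -/
def IsLeaf (D : SpliceDiagram) (v : D.V) : Prop :=
  ¬ D.isArrow v ∧ ¬ D.isRoot v ∧ D.valency v = 1

/-- The vertices with adjacent weights: the root vertex and the nodes. -/
def HasWeights (D : SpliceDiagram) (v : D.V) : Prop :=
  ¬ D.isArrow v ∧ (D.isRoot v ∨ 2 ≤ D.valency v)

/-- Isomorphism of splice diagrams, rooted or unrooted. -/
structure Iso (D E : SpliceDiagram) where
  toEquiv : D.V ≃ E.V
  adj_iff : ∀ u v, E.graph.Adj (toEquiv u) (toEquiv v) ↔ D.graph.Adj u v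
  arrow_iff : ∀ v, E.isArrow (toEquiv v) ↔ D.isArrow v
  root_iff : ∀ v, E.isRoot (toEquiv v) ↔ D.isRoot v
  weight_eq : ∀ u v, D.graph.Adj u v → D.HasWeights u →
    E.weight (toEquiv u) (toEquiv v) = D.weight u v

/-- Delete a vertex together with the edges at it. -/
def delete (D : SpliceDiagram) (v : D.V) : SpliceDiagram where
  V := {u : D.V // u ≠ v}
  graph := D.graph.comap Subtype.val
  isArrow u := D.isArrow u
  isRoot u := D.isRoot u
  weight u w := D.weight u w

open scoped Classical in
/-- Remove a vertex `v` and coalesce the edges at it: the neighbours of `v` become adjacent, and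
the new edge keeps the weights at its two ends. -/
noncomputable def coalesce (D : SpliceDiagram) (v : D.V) : SpliceDiagram where
  V := {u : D.V // u ≠ v}
  graph := SimpleGraph.fromRel fun u w =>
    D.graph.Adj u w ∨ (D.graph.Adj u v ∧ D.graph.Adj v w)
  isArrow u := D.isArrow u
  isRoot u := D.isRoot u
  weight u w := if D.graph.Adj u w then D.weight u w else D.weight u v

/-- The two reductions. First: an edge with weight `1` leading to a leaf is deleted, with the
leaf. Second: a node of valency two, other than the root, is removed and the adjacent edges are
coalesced. -/
inductive Step : SpliceDiagram → SpliceDiagram → Prop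
  | deleteLeaf (D : SpliceDiagram) (u v : D.V) (huv : D.graph.Adj u v) (hv : D.IsLeaf v)
      (hu : D.HasWeights u) (hw : D.weight u v = 1) : Step D (D.delete v)
  | removeNode (D : SpliceDiagram) (v : D.V) (hv : ¬ D.isArrow v) (hr : ¬ D.isRoot v)
      (h2 : D.valency v = 2) : Step D (D.coalesce v)

/-- No reduction applies. -/
def IsReduced (D : SpliceDiagram) : Prop := ∀ E, ¬ Step D E

/-- `E` is (isomorphic to) a reduced diagram obtained from `D` by reductions. -/
def ReducesTo (D E : SpliceDiagram) : Prop :=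
  ∃ E', Relation.ReflTransGen Step D E' ∧ E'.IsReduced ∧ Nonempty (Iso E' E)

/-- Change the root vertex to an ordinary vertex. -/
def unroot (D : SpliceDiagram) : SpliceDiagram where
  V := D.V
  graph := D.graph
  isArrow := D.isArrow
  isRoot _ := False
  weight := D.weight

open scoped Classical in
/-- Place a root vertex at an existing vertex. At a leaf, which carries no weight, the adjacent
weight becomes `1`. -/
noncomputable def rootAtVertex (D : SpliceDiagram) (v : D.V) : SpliceDiagram where
  V := D.V
  graph := D.graph
  isArrow := D.isArrow
  isRoot u := u = v
  weight u w := if u = v ∧ D.IsLeaf v then 1 else D.weight u w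

/-- Adjacency after subdividing the edge `ab` by a new vertex `none`. -/
def subdivideRel (D : SpliceDiagram) (a b : D.V) : Option D.V → Option D.V → Prop
  | none, none => False
  | none, some u => u = a ∨ u = b
  | some u, none => u = a ∨ u = b
  | some u, some w => D.graph.Adj u w ∧ ¬ (u = a ∧ w = b) ∧ ¬ (u = b ∧ w = a)

open scoped Classical in
/-- Weights after subdividing the edge `ab` by a new root vertex `none`. -/
noncomputable def subdivideWeight (D : SpliceDiagram) (a b : D.V) : Option D.V → Option D.V → ℤ
  | none, _ => 1
  | some u, none => if u = a then D.weight a b else D.weight b a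
  | some u, some w => D.weight u w

/-- Place a root vertex on the existing edge `ab`. -/
noncomputable def rootOnEdge (D : SpliceDiagram) (a b : D.V) : SpliceDiagram where
  V := Option D.V
  graph := SimpleGraph.fromRel (D.subdivideRel a b)
  isArrow v := ∃ u, v = some u ∧ D.isArrow u
  isRoot v := v = none
  weight := D.subdivideWeight a b

/-- The vertices of the exceptional diagrams: the root, two nodes, a leaf at either node, and
`d` arrowheads at either node. -/
inductive ExcVertex (d : ℕ) : Type
  | root
  | nodeL
  | nodeR
  | leafL
  | leafR
  | arrowL (i : Fin d)
  | arrowR (i : Fin d)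

/-- The edges of the exceptional diagrams. -/
def ExcVertex.rel {d : ℕ} : ExcVertex d → ExcVertex d → Prop
  | .root, .nodeL => True
  | .root, .nodeR => True
  | .nodeL, .leafL => True
  | .nodeR, .leafR => True
  | .nodeL, .arrowL _ => True
  | .nodeR, .arrowR _ => True
  | _, _ => False

/-- The weights of the exceptional diagrams. -/
def ExcVertex.weight {d : ℕ} (p q : ℕ) : ExcVertex d → ExcVertex d → ℤ
  | .nodeL, .root => -(q : ℤ)
  | .nodeL, .leafL => p
  | .nodeR, .root => -(p : ℤ)
  | .nodeR, .leafR => q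
  | _, _ => 1

/-- The (not necessarily reduced) exceptional diagram: the root is joined to a left node with
weight `-q` towards the root, a leaf along an edge of weight `p`, and `d` arrows, and to a right
node with weight `-p` towards the root, a leaf along an edge of weight `q`, and `d` arrows. -/
def exceptional (p q d : ℕ) : SpliceDiagram where
  V := ExcVertex d
  graph := SimpleGraph.fromRel ExcVertex.rel
  isArrow v := (∃ i, v = .arrowL i) ∨ ∃ i, v = .arrowR i
  isRoot v := v = .root
  weight := ExcVertex.weight p q

/-- The exceptional reduced rooted diagrams. -/
def IsExceptional (D : SpliceDiagram) : Prop :=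
  ∃ p q d : ℕ, 1 ≤ q ∧ q ≤ p ∧ Nat.Coprime p q ∧ 1 < p * d ∧ (exceptional p q d).ReducesTo D

/-- A reduced rooted diagram is minimal if it is exceptional, or if it results from the reduced
unrooted diagram by placing a root vertex at an existing (non-arrowhead) vertex or on an
existing edge. -/
def IsMinimal (D : SpliceDiagram) : Prop :=
  D.IsExceptional ∨ ∃ U : SpliceDiagram, D.unroot.ReducesTo U ∧
    ((∃ v : U.V, ¬ U.isArrow v ∧ Nonempty (Iso (U.rootAtVertex v) D)) ∨
      ∃ a b : U.V, U.graph.Adj a b ∧ Nonempty (Iso (U.rootOnEdge a b) D))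

end SpliceDiagram

/-! ### Puiseux expansions at infinity of a fibre -/

/-- Series with exponents in `ℚ` and complex coefficients, in the variable `x⁻¹`: the
coefficient of `x ^ r` is the coefficient at `-r`. -/
abbrev InfSeries : Type := HahnSeries ℚ ℂ

namespace InfSeries

/-- The coefficient of `x ^ r`. -/
def xcoeff (s : InfSeries) (r : ℚ) : ℂ := HahnSeries.coeff s (-r)

/-- The series `x`. -/
noncomputable def X : InfSeries := HahnSeries.single (-1 : ℚ) (1 : ℂ)

/-- Puiseux series at infinity: the exponents have a common denominator. -/
def IsPuiseux (s : InfSeries) : Prop :=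
  ∃ n : ℕ, 0 < n ∧ ∀ r : ℚ, s.xcoeff r ≠ 0 → ∃ m : ℤ, (n : ℚ) * r = m

/-- The terms of `s'` with exponents in `I` are those of a conjugate of `s`, that is, of the
series obtained from `s` by `x ^ (1 / n) ↦ exp (2 π i k / n) x ^ (1 / n)`. -/
def ConjOn (I : Set ℚ) (s s' : InfSeries) : Prop :=
  ∃ k : ℤ, ∀ r ∈ I,
    s'.xcoeff r = Complex.exp (2 * Real.pi * Complex.I * k * r) * s.xcoeff r

open scoped Classical in
/-- The decreasing list of the exponents larger than `r` that occur in `s`. -/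
noncomputable def exponentsAbove (s : InfSeries) (r : ℚ) : List ℚ :=
  if h : {r' : ℚ | r < r' ∧ s.xcoeff r' ≠ 0}.Finite then h.toFinset.sort (fun a b => b ≤ a) else []

end InfSeries

/-- The Newton form recursion. Write a series with exponents `r₁ > r₂ > ⋯` as
`x ^ (q₁ / p₁) (a₁ + x ^ (d₁ / (p₁ p₂)) (a₂ + ⋯))` with all fractions as reduced as possible, so
that `p₁ ⋯ pᵢ` is the common denominator of `r₁, …, rᵢ`, and choose `qᵢ₊₁` such that `dᵢ` is the
edge determinant `qᵢ₊₁ - qᵢ pᵢ pᵢ₊₁`. The arguments are the last exponent `r = rᵢ`, the product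
`M = p₁ ⋯ pᵢ`, `q = qᵢ`, `p = pᵢ` and the list of the further exponents; the value is
`(q, p)` at the last exponent of the list. -/
def newtonRec (r : ℚ) (M : ℕ) (q : ℤ) (p : ℕ) : List ℚ → ℤ × ℕ
  | [] => (q, p)
  | r' :: l =>
    let p' : ℕ := ((M : ℚ) * r').den
    let d : ℤ := ((r' - r) * M * p').num
    newtonRec r' (M * p') (d + q * p * p') p' l

/-- The weights `(q, p)` at the node for the last exponent in a decreasing list of exponents. -/
def newtonWeights (l : List ℚ) : ℤ × ℕ := newtonRec 0 1 0 1 l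

/-- Points of the line at infinity: `some β` is `[1 : β]` and `none` is `[0 : 1]`. The value is the
curve `(x, β x + s)`, respectively `(s, x)`, in linear coordinates that put the point
at `[1 : 0]`. -/
noncomputable def infChart : Option ℂ → InfSeries → Fin 2 → InfSeries
  | some β, s => ![InfSeries.X, HahnSeries.C β * InfSeries.X + s]
  | none, s => ![s, InfSeries.X]

namespace MvPolynomial

/-- The Puiseux expansions at infinity of the fibre `f = c` at the point `P` at infinity. Only
exponents smaller than `1` occur, as the point is `[1 : 0]` in the coordinates used. -/
def puiseuxAt (f : MvPolynomial (Fin 2) ℂ) (c : ℂ) (P : Option ℂ) : Set InfSeries :=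
  {s | s.IsPuiseux ∧ (∀ r : ℚ, s.xcoeff r ≠ 0 → r < 1) ∧
    eval₂ (HahnSeries.C : ℂ →+* InfSeries) (infChart P s) f = HahnSeries.C c}

/-- The expansions whose initial segment before `x ^ r` is, up to conjugation, that of `s`. -/
def puiseuxBall (f : MvPolynomial (Fin 2) ℂ) (c : ℂ) (P : Option ℂ) (s : InfSeries) (r : ℚ) :
    Set InfSeries :=
  {s' ∈ f.puiseuxAt c P | InfSeries.ConjOn (Set.Ioi r) s s'}

/-- The branch at infinity of `s`: the conjugates of `s`. -/
def puiseuxBranch (f : MvPolynomial (Fin 2) ℂ) (c : ℂ) (P : Option ℂ) (s : InfSeries) :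
    Set InfSeries :=
  {s' ∈ f.puiseuxAt c P | InfSeries.ConjOn Set.univ s s'}

/-- The expansion `s` has a relevant term at the exponent `r`: some expansion with the same terms
before `x ^ r` has a non-zero term there, and the terms before `x ^ r` do not yet determine `s`
among all expansions at the point (of its own branch or of another one). So the relevant terms
of `s` reach exactly to where `s` is separated from its conjugates, which is the last `pᵢ > 1`,
and from the other branches. -/
def IsRelevant (f : MvPolynomial (Fin 2) ℂ) (c : ℂ) (P : Option ℂ) (s : InfSeries) (r : ℚ) :
    Prop :=
  (∃ s' ∈ f.puiseuxAt c P, s' ≠ s ∧ ∀ r' > r, s'.xcoeff r' = s.xcoeff r') ∧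
  ∃ s' ∈ f.puiseuxAt c P, s'.xcoeff r ≠ 0 ∧ ∀ r' > r, s'.xcoeff r' = s.xcoeff r'

end MvPolynomial

/-! ### The splice diagram of a fibre -/

/-- Names for vertices. A node belongs to a point `P` at infinity, an exponent `r` and the set `B`
of the expansions that share (up to conjugation) an initial segment before `x ^ r`; a leaf is named
after the node to which it is attached; an arrowhead is a branch `B` at `P`. -/
inductive SpliceVertex : Type
  | root
  | node (P : Option ℂ) (r : ℚ) (B : Set InfSeries)
  | leaf (P : Option ℂ) (r : ℚ) (B : Set InfSeries)
  | arrow (P : Option ℂ) (B : Set InfSeries)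

namespace SpliceVertex

/-- The vertices of the diagram of the fibre `f = c`. There is a node for every relevant term (so
identical initial segments of expansions are merged), and a leaf at every node at which no
expansion has coefficient zero. -/
def IsVertex (f : MvPolynomial (Fin 2) ℂ) (c : ℂ) : SpliceVertex → Prop
  | root => True
  | node P r B => ∃ s ∈ f.puiseuxAt c P, f.IsRelevant c P s r ∧ B = f.puiseuxBall c P s r
  | leaf P r B => (∃ s ∈ f.puiseuxAt c P, f.IsRelevant c P s r ∧ B = f.puiseuxBall c P s r) ∧
      ∀ s ∈ B, s.xcoeff r ≠ 0
  | arrow P B => ∃ s ∈ f.puiseuxAt c P, B = f.puiseuxBranch c P s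

/-- `Above u v`: the vertex `u` lies on the path from the root to `v`, and `u ≠ v`. -/
def Above : SpliceVertex → SpliceVertex → Prop
  | root, root => False
  | root, _ => True
  | node P r B, node P' r' B' => P = P' ∧ r' < r ∧ B' ⊆ B
  | node P r B, leaf P' r' B' => P = P' ∧ r' ≤ r ∧ B' ⊆ B
  | node P _ B, arrow P' B' => P = P' ∧ B' ⊆ B
  | _, _ => False

/-- The weight `q` of a node on the edge towards the root. -/
noncomputable def rootWeight (r : ℚ) (B : Set InfSeries) : ℤ :=
  (newtonWeights ((Classical.epsilon fun s => s ∈ B).exponentsAbove r ++ [r])).1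

/-- The weight `p` of a node on the edge that belongs to the coefficient zero. -/
noncomputable def zeroWeight (r : ℚ) (B : Set InfSeries) : ℤ :=
  (newtonWeights ((Classical.epsilon fun s => s ∈ B).exponentsAbove r ++ [r])).2

/-- The vertex lies in the direction of the coefficient zero of `x ^ r`. -/
def InZeroDirection (r : ℚ) : SpliceVertex → Prop
  | root => False
  | leaf _ r' B => r' = r ∨ ∀ s ∈ B, s.xcoeff r = 0
  | node _ _ B => ∀ s ∈ B, s.xcoeff r = 0
  | arrow _ B => ∀ s ∈ B, s.xcoeff r = 0

open scoped Classical in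
/-- The weight at `u` on the edge from `u` to `v`: at a node, it is `q` towards the root, `p` in
the direction of the coefficient zero (with a leaf or with further expansions), and `1` otherwise;
the weights at the root are `1`. -/
noncomputable def weight : SpliceVertex → SpliceVertex → ℤ
  | node P r B, v =>
    if Above v (node P r B) then rootWeight r B
    else if InZeroDirection r v then zeroWeight r B else 1
  | _, _ => 1

end SpliceVertex

namespace MvPolynomial

/-- The (possibly unreduced) rooted splice diagram of the reduced fibre `f = c`. Edges join a vertex
to the next one on the way from the root. -/
noncomputable def fibreDiagram (f : MvPolynomial (Fin 2) ℂ) (c : ℂ) : SpliceDiagram where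
  V := {v : SpliceVertex // v.IsVertex f c}
  graph := SimpleGraph.fromRel fun u v =>
    u.1.Above v.1 ∧ ∀ w : SpliceVertex, w.IsVertex f c → ¬ (u.1.Above w ∧ w.Above v.1)
  isArrow v := ∃ P B, v.1 = .arrow P B
  isRoot v := v.1 = .root
  weight u v := u.1.weight v.1

/-- `D` is the regular reduced rooted splice diagram of `f`: the reduced rooted splice diagram
of all but finitely many fibres of `f`. -/
def IsRegularRootedSpliceDiagram (f : MvPolynomial (Fin 2) ℂ) (D : SpliceDiagram) : Prop :=
  ∀ᶠ c in Filter.cofinite, (f.fibreDiagram c).ReducesTo D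

/-- `[a : b]` is a point at infinity of `f`: the homogeneous part of highest degree vanishes. -/
def IsPointAtInfinity (f : MvPolynomial (Fin 2) ℂ) (a b : ℂ) : Prop :=
  (a, b) ≠ (0, 0) ∧ eval ![a, b] (homogeneousComponent f.totalDegree f) = 0

/-- Composition with `(x, y) ↦ (x - c y ^ q, y)`, as an algebra homomorphism. -/
noncomputable def triangularHom (c : ℂ) (q : ℕ) :
    MvPolynomial (Fin 2) ℂ →ₐ[ℂ] MvPolynomial (Fin 2) ℂ :=
  aeval ![X 0 - C c * X 1 ^ q, X 1]

theorem triangularHom_comp (c : ℂ) (q : ℕ) :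
    (triangularHom c q).comp (triangularHom (-c) q) = AlgHom.id ℂ _ := by
  ext i
  fin_cases i <;> simp [triangularHom]

/-- The triangular automorphism `(x, y) ↦ (x - c y ^ q, y)`. -/
noncomputable def triangularAut (c : ℂ) (q : ℕ) :
    MvPolynomial (Fin 2) ℂ ≃ₐ[ℂ] MvPolynomial (Fin 2) ℂ :=
  AlgEquiv.ofAlgHom (triangularHom c q) (triangularHom (-c) q) (triangularHom_comp c q)
    (by simpa using triangularHom_comp (-c) q)

end MvPolynomial

/-! A single fibre `f = c` whose diagram reduces to `D` suffices. Turn the root of the reduced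
diagram `D` into an ordinary vertex. If this permits no reduction, or if the root has valency two,
then putting the root back on the vertex or on the coalesced edge shows that `D` is minimal. So in a
non-minimal `D` the root has one neighbour, and the weight there towards the root is `1`
(`exists_neighbor_of_not_isMinimal`).

Reductions preserve the arrowheads, the weights in each direction, and the extra leaves of weight
other than `1`. So the unreduced tree has a node `n` above all arrowheads, with weight `1` towards
the root, such that extra leaves at nodes between the root and `n` have weight `1`
(`IsPruning.exists_of_not_isMinimal`). Hence all expansions belong to the point `[1 : 0]` and share,
up to conjugation, the initial segment before the exponent `r` of `n`. If that segment had a first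
exponent `r₀`, all expansions would have a non-zero term there, so an extra leaf of weight `r₀.den`
would be attached. Then `r₀ < 1` would be an integer, thus `r₀ ≤ 0`, and all numbers `qᵢ` up to `n`
would be nonpositive, contrary to the weight `1`. So the segment is empty, the weight is `r.num =
1`, and `r = 1 / p` with `p > 1`.

Let `N` be the degree of `f`. No expansion has an exponent above `1 / p`, so by the theorem of
Newton and Puiseux (`exists_isRoot_expand`) no edge of the Newton polygon violates `p i + j ≤ N` for
the monomials `x ^ i y ^ j` of `f` (`weight_le_of_puiseuxAt`). An expansion with leading term `a x ^
(1 / p)`, `a ≠ 0`, annihilates the form of weight `N`. This says exactly that replacing `x` by `x +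
a ^ (-p) y ^ p` cancels the coefficient of `y ^ N`; all other terms have degree below `N`. -/

/-! ### Hensel's lemma and nonzero roots -/

/-- Hensel's lemma for polynomials that need not be monic. -/
theorem IsAdicComplete.exists_isRoot_of_eval_mem {R : Type*} [CommRing R] (I : Ideal R)
    [IsAdicComplete I R] (f : Polynomial R) (a₀ : R) (h₁ : f.eval a₀ ∈ I)
    (h₂ : IsUnit (Ideal.Quotient.mk I (f.derivative.eval a₀))) :
    ∃ a : R, f.IsRoot a ∧ a - a₀ ∈ I := by
  classical
  open Polynomial in
  let f' := derivative f
  -- Newton iteration. `Ring.inverse` is a true inverse here, since `hf'c` shows the derivative to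
  -- be a unit at every iterate.
  let c : ℕ → R := fun n => Nat.recOn n a₀ fun _ b => b - f.eval b * Ring.inverse (f'.eval b)
  have hc : ∀ n, c (n + 1) = c n - f.eval (c n) * Ring.inverse (f'.eval (c n)) := fun n => rfl
  have hc_mod : ∀ n, c n ≡ a₀ [SMOD I] := by
    intro n
    induction n with
    | zero => rfl
    | succ n ih =>
      rw [hc, sub_eq_add_neg, ← add_zero a₀]
      refine ih.add ?_
      rw [SModEq.zero, Ideal.neg_mem_iff]
      refine I.mul_mem_right _ ?_
      rw [← SModEq.zero] at h₁ ⊢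
      exact (ih.eval f).trans h₁
  have hf'c : ∀ n, IsUnit (f'.eval (c n)) := by
    intro n
    have := isLocalHom_of_le_jacobson_bot I (IsAdicComplete.le_jacobson_bot I)
    apply IsUnit.of_map (Ideal.Quotient.mk I)
    convert! h₂ using 1
    exact SModEq.def.mp ((hc_mod n).eval _)
  have hfcI : ∀ n, f.eval (c n) ∈ I ^ (n + 1) := by
    intro n
    induction n with
    | zero => simpa only [Nat.rec_zero, zero_add, pow_one] using! h₁
    | succ n ih =>
      rw [← Polynomial.taylor_eval_sub (c n), hc, sub_eq_add_neg, sub_eq_add_neg,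
        add_neg_cancel_comm]
      rw [Polynomial.eval_eq_sum,
        Polynomial.sum_over_range' _ _ _ (lt_add_of_pos_right _ zero_lt_two), ←
        Finset.sum_range_add_sum_Ico _ (Nat.le_add_left _ _)]
      swap
      · intro i
        rw [zero_mul]
      refine Ideal.add_mem _ ?_ ?_
      -- The Newton step makes the constant and linear Taylor terms cancel. A term of degree `i ≥ 2`
      -- lies in `I ^ (i * (n + 1))`, and `i * (n + 1) ≥ n + 2`.
      · rw [← one_add_one_eq_two, Finset.sum_range_succ, Finset.range_one, Finset.sum_singleton,
          Polynomial.taylor_coeff_zero, Polynomial.taylor_coeff_one, pow_zero, pow_one, mul_one,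
          mul_neg, mul_left_comm, Ring.mul_inverse_cancel _ (hf'c n), mul_one, add_neg_cancel]
        exact Ideal.zero_mem _
      · refine Submodule.sum_mem _ ?_
        simp only [Finset.mem_Ico]
        rintro i ⟨h2i, _⟩
        have aux : n + 2 ≤ i * (n + 1) := by trans 2 * (n + 1) <;> nlinarith only [h2i]
        refine Ideal.mul_mem_left _ _ (Ideal.pow_le_pow_right aux ?_)
        rw [pow_mul']
        exact Ideal.pow_mem_pow ((Ideal.neg_mem_iff _).2 <| Ideal.mul_mem_right _ _ ih) _
  have aux : ∀ m n, m ≤ n → c m ≡ c n [SMOD (I ^ m • ⊤ : Ideal R)] := by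
    intro m n hmn
    rw [← Ideal.one_eq_top, Ideal.smul_eq_mul, mul_one]
    obtain ⟨k, rfl⟩ := Nat.exists_eq_add_of_le hmn
    clear hmn
    induction k with
    | zero => rw [add_zero]
    | succ k ih =>
      rw [← add_assoc, hc, ← add_zero (c m), sub_eq_add_neg]
      refine ih.add ?_
      symm
      rw [SModEq.zero, Ideal.neg_mem_iff]
      refine Ideal.mul_mem_right _ _ (Ideal.pow_le_pow_right ?_ (hfcI _))
      rw [add_assoc]
      exact le_self_add
  obtain ⟨a, ha⟩ := IsPrecomplete.prec' c (aux _ _)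
  refine ⟨a, ?_, ?_⟩
  · change f.eval a = 0
    suffices ∀ n, f.eval a ≡ 0 [SMOD (I ^ n • ⊤ : Ideal R)] from IsHausdorff.haus' _ this
    intro n
    specialize ha n
    rw [← Ideal.one_eq_top, Ideal.smul_eq_mul, mul_one] at ha ⊢
    refine (ha.symm.eval f).trans ?_
    rw [SModEq.zero]
    exact Ideal.pow_le_pow_right le_self_add (hfcI _)
  · specialize ha (0 + 1)
    rw [hc, pow_one, ← Ideal.one_eq_top, Ideal.smul_eq_mul, mul_one, sub_eq_add_neg] at ha
    rw [← SModEq.sub_mem, ← add_zero a₀]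
    refine ha.symm.trans (SModEq.rfl.add ?_)
    rw [SModEq.zero, Ideal.neg_mem_iff]
    exact Ideal.mul_mem_right _ _ h₁

namespace Polynomial

/-- Divide out the power of the variable. The quotient does not vanish at `0`, and it is not
constant because `E` is not a monomial, so any of its roots will do. -/
theorem exists_isRoot_ne_zero_of_coeff_ne_zero {K : Type*} [Field K] [IsAlgClosed K]
    (E : Polynomial K) {i j : ℕ} (hij : i ≠ j) (hi : E.coeff i ≠ 0) (hj : E.coeff j ≠ 0) :
    ∃ a, a ≠ 0 ∧ E.IsRoot a := by
  have hE : E ≠ 0 := by rintro rfl; simp at hi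
  obtain ⟨Q, hQ, hnd⟩ := E.exists_eq_pow_rootMultiplicity_mul_and_not_dvd hE 0
  rw [C_0, sub_zero] at hQ hnd
  rw [X_dvd_iff] at hnd
  have hdeg : Q.degree ≠ 0 := by
    intro h
    rw [eq_C_of_degree_eq_zero h] at hQ
    rw [hQ] at hi hj
    simp only [coeff_mul_C, coeff_X_pow] at hi hj
    grind
  obtain ⟨a, ha⟩ := IsAlgClosed.exists_root Q hdeg
  refine ⟨a, ?_, ?_⟩
  · rintro rfl
    exact hnd (by rw [coeff_zero_eq_eval_zero]; exact ha)
  · rw [hQ, IsRoot, eval_mul, ha.eq_zero, mul_zero]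

end Polynomial

namespace PowerSeries

/-- A simple root modulo `X` lifts. -/
theorem exists_isRoot_of_constantCoeff {K : Type*} [Field K] (F : Polynomial K⟦X⟧)
    (h₀ : constantCoeff (F.coeff 0) = 0) (h₁ : constantCoeff (F.coeff 1) ≠ 0) :
    ∃ z : K⟦X⟧, constantCoeff z = 0 ∧ F.IsRoot z := by
  obtain ⟨z, hz, hz'⟩ := IsAdicComplete.exists_isRoot_of_eval_mem (Ideal.span {X}) F 0
    (by rwa [← Polynomial.coeff_zero_eq_eval_zero, Ideal.mem_span_singleton, X_dvd_iff])
    (by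
      rw [← Polynomial.coeff_zero_eq_eval_zero, Polynomial.coeff_derivative]
      apply IsUnit.map
      rw [isUnit_iff_constantCoeff]
      simpa using h₁)
  refine ⟨z, ?_, hz⟩
  rwa [sub_zero, Ideal.mem_span_singleton, X_dvd_iff] at hz'

end PowerSeries

/-! ### The theorem of Newton and Puiseux over power series -/

namespace PowerSeries

variable {K : Type*} [Field K]

/-- Dividing out the initial forms along an edge of the Newton polygon. -/
theorem exists_newton_transform (H : Polynomial K⟦X⟧) {m j₀ n : ℕ} (hj₀ : j₀ < m) (hn : n + j₀ = m)
    (h0 : ∀ j < m, constantCoeff (H.coeff j) = 0) (hm : constantCoeff (H.coeff m) ≠ 0)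
    {k : ℕ} (hk : (H.coeff j₀).order = k)
    (hmin : ∀ j < m, ((k * (m - j) : ℕ) : ℕ∞) ≤ n * (H.coeff j).order) (hn0 : n ≠ 0) :
    ∃ G : Polynomial K⟦X⟧,
      Polynomial.C (X ^ (k * m)) * G =
        (H.map (expand n hn0 : K⟦X⟧ →ₐ[K] K⟦X⟧).toRingHom).comp
          (Polynomial.C (X ^ k) * Polynomial.X) ∧
      (∀ j, m < j → constantCoeff (G.coeff j) = 0) ∧
      constantCoeff (G.coeff m) ≠ 0 ∧ constantCoeff (G.coeff j₀) ≠ 0 ∧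
      ∀ j, H.coeff j = 0 → G.coeff j = 0 := by
  have hkpos : 0 < k := by
    rw [Nat.pos_iff_ne_zero]
    rintro rfl
    have := h0 j₀ hj₀
    rw [← coeff_zero_eq_constantCoeff_apply] at this
    exact (order_eq_nat.1 hk).1 this
  -- The term of degree `j` has order at least `n * ord + k * j`, where `ord` is the order of
  -- `H.coeff j`. For `j < m` the slope condition bounds this below by `k * m`; for `j ≥ m` the
  -- factor `X ^ (k * j)` is enough.
  have hdvd : ∀ j, (X : K⟦X⟧) ^ (k * m) ∣ expand n hn0 (H.coeff j) * X ^ (k * j) := by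
    intro j
    by_cases hj : m ≤ j
    · exact dvd_mul_of_dvd_right (pow_dvd_pow _ (Nat.mul_le_mul_left _ hj)) _
    · push Not at hj
      have h1 : (X : K⟦X⟧) ^ (k * (m - j)) ∣ expand n hn0 (H.coeff j) := by
        rw [X_pow_dvd_iff]
        intro i hi
        apply coeff_of_lt_order
        rw [order_expand, nsmul_eq_mul]
        exact lt_of_lt_of_le (by exact_mod_cast hi) (hmin j hj)
      have h2 := mul_dvd_mul_right h1 (X ^ (k * j))
      rwa [← pow_add, ← mul_add, Nat.sub_add_cancel hj.le] at h2
  choose g hg using hdvd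
  have hX : ∀ i : ℕ, (X : K⟦X⟧) ^ i ≠ 0 := fun i => pow_ne_zero _ X_ne_zero
  have hg0 : ∀ j, H.coeff j = 0 → g j = 0 := by
    intro j hj
    have := hg j
    rw [hj, map_zero, zero_mul] at this
    exact (mul_eq_zero.1 this.symm).resolve_left (hX _)
  let G : Polynomial K⟦X⟧ := ∑ j ∈ Finset.range (H.natDegree + 1), Polynomial.monomial j (g j)
  have hG : ∀ j, G.coeff j = g j := by
    intro j
    simp only [G, Polynomial.finsetSum_coeff, Polynomial.coeff_monomial]
    rw [Finset.sum_ite_eq' (Finset.range (H.natDegree + 1)) j]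
    split_ifs with h
    · rfl
    · rw [hg0 j (Polynomial.coeff_eq_zero_of_natDegree_lt (by simpa using h))]
  refine ⟨G, ?_, ?_, ?_, ?_, ?_⟩
  · ext1 j
    rw [Polynomial.coeff_C_mul, hG, ← hg, Polynomial.comp_C_mul_X_coeff, Polynomial.coeff_map,
      ← pow_mul]
    rfl
  · intro j hj
    have h := hg j
    obtain ⟨i, rfl⟩ := Nat.exists_eq_add_of_lt hj
    have : g (m + i + 1) = expand n hn0 (H.coeff (m + i + 1)) * X ^ (k * (i + 1)) := by
      apply mul_left_cancel₀ (hX (k * m))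
      rw [← h]; ring
    rw [hG, this, map_mul, map_pow, constantCoeff_X, zero_pow (by positivity), mul_zero]
  · have : g m = expand n hn0 (H.coeff m) := by
      apply mul_left_cancel₀ (hX (k * m))
      rw [← hg m]; ring
    rwa [hG, this, constantCoeff_expand]
  -- At `j₀` the slope condition is an equality, `n * k + k * j₀ = k * m`, so the lowest coefficient
  -- of `H.coeff j₀` survives.
  · have h1 : coeff (k * m) (X ^ (k * m) * g j₀) = constantCoeff (g j₀) := by
      have := coeff_X_pow_mul (g j₀) (k * m) 0
      rwa [zero_add, coeff_zero_eq_constantCoeff_apply] at this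
    have h2 : coeff (k * m) (expand n hn0 (H.coeff j₀) * X ^ (k * j₀)) = (H.coeff j₀).coeff k := by
      have : k * m = n * k + k * j₀ := by rw [← hn]; ring
      rw [this, coeff_mul_X_pow, coeff_expand_mul]
    rw [hG, ← h1, ← hg, h2]
    exact (order_eq_nat.1 hk).1
  · intro j hj
    rw [hG, hg0 j hj]

theorem _root_.Polynomial.coeff_taylor_eq_zero_of_lt_rootMultiplicity {R : Type*} [CommRing R]
    (E : Polynomial R) (a : R) {j : ℕ} (hj : j < E.rootMultiplicity a) :
    (Polynomial.taylor a E).coeff j = 0 := by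
  rw [Polynomial.rootMultiplicity_eq_natTrailingDegree] at hj
  exact Polynomial.coeff_eq_zero_of_lt_natTrailingDegree hj

theorem _root_.Polynomial.coeff_taylor_rootMultiplicity_ne_zero {R : Type*} [CommRing R]
    {E : Polynomial R} (hE : E ≠ 0) (a : R) :
    (Polynomial.taylor a E).coeff (E.rootMultiplicity a) ≠ 0 := by
  rw [Polynomial.rootMultiplicity_eq_natTrailingDegree]
  have : Polynomial.taylor a E ≠ 0 := by
    rw [Ne, Polynomial.taylor_eq_zero]; exact hE
  exact mt Polynomial.trailingCoeff_eq_zero.1 this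

/-- A root of multiplicity `m` would make `E` a multiple of `(X - a) ^ m`, whose coefficient `-m a`
at degree `m - 1` is not zero in characteristic zero. -/
theorem _root_.Polynomial.rootMultiplicity_lt_of_coeff_eq_zero [CharZero K] {E : Polynomial K}
    {m : ℕ} (hm0 : 0 < m) (hdeg : ∀ j, m < j → E.coeff j = 0) (hm : E.coeff m ≠ 0)
    (hm1 : E.coeff (m - 1) = 0) {a : K} (ha : a ≠ 0) : E.rootMultiplicity a < m := by
  have hnd : E.natDegree = m := Polynomial.natDegree_eq_of_le_of_coeff_ne_zero
    (Polynomial.natDegree_le_iff_coeff_eq_zero.2 hdeg) hm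
  by_contra! hle
  obtain ⟨Q, hQ⟩ := (pow_dvd_pow _ hle).trans (E.pow_rootMultiplicity_dvd a)
  have hE : E ≠ 0 := by rintro rfl; simp at hm
  have hQ0 : Q ≠ 0 := by rintro rfl; simp [hE] at hQ
  have hQd : Q.natDegree = 0 := by
    have := congrArg Polynomial.natDegree hQ
    rw [Polynomial.natDegree_mul (pow_ne_zero _ (Polynomial.X_sub_C_ne_zero a)) hQ0,
      Polynomial.natDegree_pow, Polynomial.natDegree_X_sub_C, hnd] at this
    omega
  rw [Polynomial.eq_C_of_natDegree_eq_zero hQd] at hQ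
  have h1 : Q.coeff 0 ≠ 0 := by
    intro h; rw [h] at hQ; simp [hE] at hQ
  rw [hQ, Polynomial.coeff_mul_C, sub_eq_add_neg, ← Polynomial.C_neg,
    Polynomial.coeff_X_add_C_pow] at hm1
  have h2 : m - (m - 1) = 1 := by omega
  have h3 : ((m.choose (m - 1) : ℕ) : K) ≠ 0 := by
    exact_mod_cast (Nat.choose_pos (by omega)).ne'
  rw [h2, pow_one] at hm1
  exact mul_ne_zero (mul_ne_zero (neg_ne_zero.2 ha) h3) h1 hm1

/-- The theorem of Newton and Puiseux: after passing to a root of `X`, a polynomial over `K⟦X⟧`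
with a root `0` modulo `X` has a root in the maximal ideal. -/
theorem exists_isRoot_expand [IsAlgClosed K] [CharZero K] (m : ℕ) :
    ∀ H : Polynomial K⟦X⟧, 0 < m → (∀ j < m, constantCoeff (H.coeff j) = 0) →
      constantCoeff (H.coeff m) ≠ 0 →
      ∃ (N : ℕ) (hN : N ≠ 0) (z : K⟦X⟧), constantCoeff z = 0 ∧
        (H.map (expand N hN : K⟦X⟧ →ₐ[K] K⟦X⟧).toRingHom).IsRoot z := by
  induction m using Nat.strong_induction_on with
  | _ m ih =>
  classical
  intro H hm0 h0 hm
  -- Tschirnhausen translation. The Hasse derivative of order `m - 1` has linear coefficient `m`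
  -- times `H.coeff m`, so `0` is a simple root modulo `X`. Translation by its lift `z₀` kills the
  -- coefficient of degree `m - 1`.
  obtain ⟨z₀, hz₀, hz₀'⟩ := exists_isRoot_of_constantCoeff (Polynomial.hasseDeriv (m - 1) H)
    (by rw [Polynomial.hasseDeriv_coeff, map_mul, zero_add, h0 _ (by omega), mul_zero])
    (by
      have : 1 + (m - 1) = m := by omega
      rw [Polynomial.hasseDeriv_coeff, map_mul, map_natCast, this]
      exact mul_ne_zero (by exact_mod_cast (Nat.choose_pos (by omega)).ne') hm)
  have hroot : ∀ {N : ℕ} (hN : N ≠ 0) (z : K⟦X⟧),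
      ((Polynomial.taylor z₀ H).map (expand N hN : K⟦X⟧ →ₐ[K] K⟦X⟧).toRingHom).IsRoot z →
      (H.map (expand N hN : K⟦X⟧ →ₐ[K] K⟦X⟧).toRingHom).IsRoot (z + expand N hN z₀) := by
    intro N hN z h
    rw [Polynomial.IsRoot, Polynomial.taylor_apply, Polynomial.map_comp] at h
    simpa [Polynomial.eval_comp] using h
  have hmap : (Polynomial.taylor z₀ H).map constantCoeff = H.map constantCoeff := by
    rw [Polynomial.taylor_apply, Polynomial.map_comp]
    simp [hz₀]
  have hcc : ∀ j, constantCoeff ((Polynomial.taylor z₀ H).coeff j) =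
      constantCoeff (H.coeff j) := by
    intro j
    rw [← Polynomial.coeff_map, hmap, Polynomial.coeff_map]
  have hm1 : (Polynomial.taylor z₀ H).coeff (m - 1) = 0 := by
    rw [Polynomial.taylor_coeff]; exact hz₀'
  by_cases hz : (Polynomial.taylor z₀ H).coeff 0 = 0
  · refine ⟨1, one_ne_zero, 0 + expand 1 one_ne_zero z₀, by simp [hz₀], hroot _ _ ?_⟩
    rw [Polynomial.IsRoot, ← Polynomial.coeff_zero_eq_eval_zero, Polynomial.coeff_map, hz, map_zero]
  generalize Polynomial.taylor z₀ H = F at *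
  simp only [← hcc] at h0 hm
  -- The smallest slope of the Newton polygon. It need not be in lowest terms: adjoining a root of
  -- `X` of order `m - j₀` is enough.
  obtain ⟨j₀, hj₀, hmin⟩ := Finset.exists_min_image
    ((Finset.range m).filter fun j => F.coeff j ≠ 0)
    (fun j => ((F.coeff j).order.toNat : ℚ) / (m - j : ℕ)) ⟨0, by simp [hm0, hz]⟩
  simp only [Finset.mem_filter, Finset.mem_range] at hj₀ hmin
  obtain ⟨hj₀m, hj₀0⟩ := hj₀
  have hord : ∀ j, F.coeff j ≠ 0 → (F.coeff j).order = ((F.coeff j).order.toNat : ℕ∞) :=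
    fun j hj => (ENat.natCast_toNat (by rwa [Ne, order_eq_top])).symm
  have hn0 : m - j₀ ≠ 0 := by omega
  obtain ⟨G, hG, hGlt, hGm, hGj, hG0⟩ := exists_newton_transform F hj₀m (n := m - j₀)
    (by omega) h0 hm (hord j₀ hj₀0)
    (by
      intro j hj
      by_cases hj0 : F.coeff j = 0
      · rw [hj0, order_zero, ENat.mul_top (by exact_mod_cast hn0)]; exact le_top
      · rw [hord j hj0]
        have := hmin j ⟨hj, hj0⟩
        have h1 : (0 : ℚ) < (m - j₀ : ℕ) := by exact_mod_cast (by omega : 0 < m - j₀)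
        have h2 : (0 : ℚ) < (m - j : ℕ) := by exact_mod_cast (by omega : 0 < m - j)
        rw [div_le_div_iff₀ h1 h2] at this
        rw [mul_comm ((m - j₀ : ℕ) : ℕ∞)]
        exact_mod_cast this) hn0
  obtain ⟨a, ha0, ha⟩ := (G.map constantCoeff).exists_isRoot_ne_zero_of_coeff_ne_zero
    (i := m) (j := j₀) (by omega) (by rwa [Polynomial.coeff_map]) (by rwa [Polynomial.coeff_map])
  have hE : G.map constantCoeff ≠ 0 := by
    intro h
    apply hGm
    rw [← Polynomial.coeff_map, h, Polynomial.coeff_zero]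
  -- The reduced polynomial has degree `m` and no term of degree `m - 1`, so the multiplicity drops
  -- and the induction applies at `a`.
  have hlt : (G.map constantCoeff).rootMultiplicity a < m := by
    refine Polynomial.rootMultiplicity_lt_of_coeff_eq_zero hm0 ?_ ?_ ?_ ha0
    · intro j hj; rw [Polynomial.coeff_map]; exact hGlt j hj
    · rwa [Polynomial.coeff_map]
    · rw [Polynomial.coeff_map, hG0 _ hm1, map_zero]
  have htay : (Polynomial.taylor (C a) G).map constantCoeff =
      Polynomial.taylor a (G.map constantCoeff) := by
    rw [Polynomial.taylor_apply, Polynomial.map_comp]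
    simp [Polynomial.taylor_apply]
  obtain ⟨N, hN, z, hz0, hz'⟩ := ih _ hlt (Polynomial.taylor (C a) G)
    ((Polynomial.rootMultiplicity_pos hE).2 ha)
    (by
      intro j hj
      rw [← Polynomial.coeff_map, htay]
      exact Polynomial.coeff_taylor_eq_zero_of_lt_rootMultiplicity _ _ hj)
    (by
      rw [← Polynomial.coeff_map, htay]
      exact Polynomial.coeff_taylor_rootMultiplicity_ne_zero hE a)
  have hk : (F.coeff j₀).order.toNat ≠ 0 := by
    intro h
    have h1 := hord j₀ hj₀0
    rw [h] at h1
    have h2 := h0 j₀ hj₀m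
    rw [← coeff_zero_eq_constantCoeff_apply] at h2
    exact (order_eq_nat.1 h1).1 h2
  generalize (F.coeff j₀).order.toNat = k at *
  -- Undo the substitutions: the root `z + a` is scaled by `X ^ k`, with `X` replaced by `X ^ N`,
  -- and the translation by `z₀` is reversed.
  refine ⟨N * (m - j₀), N.mul_ne_zero hN hn0, X ^ (N * k) * (z + C a) + expand _ _ z₀,
    ?_, hroot _ _ ?_⟩
  · simp [hz₀, hN, hk]
  · have hmm := congrArg (fun P : Polynomial K⟦X⟧ =>
      (P.map (expand N hN : K⟦X⟧ →ₐ[K] K⟦X⟧).toRingHom).eval (z + C a)) hG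
    have e1 : (G.map (expand N hN : K⟦X⟧ →ₐ[K] K⟦X⟧).toRingHom).eval (z + C a) = 0 := by
      rw [Polynomial.IsRoot, Polynomial.taylor_apply, Polynomial.map_comp] at hz'
      simpa [Polynomial.eval_comp, expand_C] using hz'
    simp only [Polynomial.map_mul, Polynomial.eval_mul, e1, mul_zero, Polynomial.map_comp,
      Polynomial.map_map, Polynomial.eval_comp] at hmm
    have e2 : ((expand N hN : K⟦X⟧ →ₐ[K] K⟦X⟧).toRingHom.comp
        (expand (m - j₀) hn0 : K⟦X⟧ →ₐ[K] K⟦X⟧).toRingHom) =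
        (expand (N * (m - j₀)) (N.mul_ne_zero hN hn0) : K⟦X⟧ →ₐ[K] K⟦X⟧).toRingHom := by
      ext1 x
      exact (expand_mul N hN _ hn0 x).symm
    rw [e2] at hmm
    rw [Polynomial.IsRoot, hmm]
    simp [pow_mul]

end PowerSeries

/-! ### Power series in a root of the variable as series at infinity -/

/-- Multiplication by `1 / n`. -/
def divNatHom (n : ℕ) : ℕ →+ ℚ where
  toFun k := k / n
  map_zero' := by simp
  map_add' a b := by push_cast; exact add_div _ _ _

theorem divNatHom_le_iff {n : ℕ} (hn : n ≠ 0) (a b : ℕ) :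
    divNatHom n a ≤ divNatHom n b ↔ a ≤ b := by
  have hn' : (0 : ℚ) < n := by exact_mod_cast Nat.pos_of_ne_zero hn
  change (a : ℚ) / n ≤ b / n ↔ _
  rw [div_le_div_iff_of_pos_right hn']
  exact_mod_cast Iff.rfl

theorem divNatHom_injective {n : ℕ} (hn : n ≠ 0) : Function.Injective (divNatHom n) :=
  fun a b h => le_antisymm ((divNatHom_le_iff hn a b).1 h.le) ((divNatHom_le_iff hn b a).1 h.ge)

/-- The ring homomorphism that sends the variable to `x ^ (-1 / n)`. -/
noncomputable def puiseuxHom (n : ℕ) (hn : n ≠ 0) : PowerSeries ℂ →+* InfSeries :=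
  (HahnSeries.embDomainRingHom (divNatHom n) (divNatHom_injective hn)
    (fun a b => divNatHom_le_iff hn a b)).comp
  (HahnSeries.toPowerSeries (R := ℂ)).symm.toRingHom

theorem coeff_puiseuxHom (n : ℕ) (hn : n ≠ 0) (z : PowerSeries ℂ) (k : ℕ) :
    (puiseuxHom n hn z).coeff ((k : ℚ) / n) = z.coeff k :=
  HahnSeries.embDomain_coeff.trans HahnSeries.coeff_toPowerSeries_symm

theorem exists_of_coeff_puiseuxHom_ne_zero {n : ℕ} {hn : n ≠ 0} {z : PowerSeries ℂ} {r : ℚ}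
    (h : (puiseuxHom n hn z).coeff r ≠ 0) : ∃ k : ℕ, r = k / n ∧ z.coeff k ≠ 0 := by
  by_cases hr : ∃ k : ℕ, r = k / n
  · obtain ⟨k, rfl⟩ := hr
    exact ⟨k, rfl, by rwa [coeff_puiseuxHom] at h⟩
  · refine absurd (HahnSeries.embDomain_of_notMem_range ?_) h
    rintro ⟨k, hk⟩
    exact hr ⟨k, hk.symm⟩

theorem puiseuxHom_C (n : ℕ) (hn : n ≠ 0) (a : ℂ) :
    puiseuxHom n hn (PowerSeries.C a) = HahnSeries.C a := by
  have : (HahnSeries.toPowerSeries (R := ℂ)).symm (PowerSeries.C a) = HahnSeries.C a := by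
    rw [RingEquiv.symm_apply_eq]
    ext k
    rw [HahnSeries.coeff_toPowerSeries, PowerSeries.coeff_C, HahnSeries.C_apply,
      HahnSeries.coeff_single]
    congr
  change HahnSeries.embDomainRingHom _ _ _ ((HahnSeries.toPowerSeries (R := ℂ)).symm _) = _
  rw [this, HahnSeries.embDomainRingHom_C]

theorem puiseuxHom_X (n : ℕ) (hn : n ≠ 0) :
    puiseuxHom n hn PowerSeries.X = HahnSeries.single (1 / n : ℚ) 1 := by
  have : (HahnSeries.toPowerSeries (R := ℂ)).symm PowerSeries.X = HahnSeries.single 1 1 := by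
    rw [RingEquiv.symm_apply_eq]
    ext k
    rw [HahnSeries.coeff_toPowerSeries, PowerSeries.coeff_X, HahnSeries.coeff_single]
    congr
  change HahnSeries.embDomain _ ((HahnSeries.toPowerSeries (R := ℂ)).symm _) = _
  rw [this, HahnSeries.embDomain_single]
  change HahnSeries.single (((1 : ℕ) : ℚ) / n) 1 = _
  rw [Nat.cast_one]

/-! ### Edges of the Newton polygon and expansions -/

namespace MvPolynomial

/-- The form of weight `M` of a polynomial in `x`, `y` with weights `n`, `k`, dehomogenized
at `x = 1`. -/
noncomputable def edgePolynomial (g : MvPolynomial (Fin 2) ℂ) (n k M : ℕ) : Polynomial ℂ :=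
  ∑ m ∈ g.support with n * m 0 + k * m 1 = M, Polynomial.monomial (m 1) (g.coeff m)

/-- The polynomial `t ^ M g(t ^ (-n), t ^ (-k) u)` in `u`. -/
noncomputable def edgeLift (g : MvPolynomial (Fin 2) ℂ) (n k M : ℕ) :
    Polynomial (PowerSeries ℂ) :=
  ∑ m ∈ g.support, Polynomial.monomial (m 1)
    (PowerSeries.C (g.coeff m) * PowerSeries.X ^ (M - (n * m 0 + k * m 1)))

variable {g : MvPolynomial (Fin 2) ℂ} {n k M : ℕ}

theorem map_edgeLift (hM : ∀ m ∈ g.support, n * m 0 + k * m 1 ≤ M) :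
    (g.edgeLift n k M).map PowerSeries.constantCoeff = g.edgePolynomial n k M := by
  rw [edgeLift, edgePolynomial, Finset.sum_filter, Polynomial.map_sum]
  refine Finset.sum_congr rfl fun m hm => ?_
  rw [Polynomial.map_monomial]
  split_ifs with h
  · simp [h]
  · have := hM m hm
    have : M - (n * m 0 + k * m 1) ≠ 0 := by omega
    simp [this]

/-- Since `n ≠ 0`, a monomial of weight `M` is determined by its exponent in `y`, so no two of them
collide. -/
theorem coeff_edgePolynomial (hn : n ≠ 0) {m : Fin 2 →₀ ℕ} (hm : n * m 0 + k * m 1 = M) :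
    (g.edgePolynomial n k M).coeff (m 1) = g.coeff m := by
  rw [edgePolynomial, Polynomial.finsetSum_coeff]
  rw [Finset.sum_eq_single m]
  · simp
  · intro m' hm' hne
    rw [Polynomial.coeff_monomial, if_neg]
    intro h
    apply hne
    have h0 : n * m' 0 = n * m 0 := by
      have := (Finset.mem_filter.1 hm').2
      rw [h] at this
      omega
    ext i
    fin_cases i
    · exact Nat.eq_of_mul_eq_mul_left (Nat.pos_of_ne_zero hn) h0
    · exact h
  · intro h
    rw [Finset.mem_filter, not_and_or] at h
    rcases h with h | h
    · rw [notMem_support_iff.1 h]; simp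
    · exact absurd hm h

/-- The substitution `y = x ^ (k / n) w` with `t = x ^ (-1 / n)`. The extra factor `N` makes room
for the ramification that the theorem of Newton and Puiseux introduces. -/
theorem eval₂_eq_edgeLift (hn : n ≠ 0) (hM : ∀ m ∈ g.support, n * m 0 + k * m 1 ≤ M)
    {N : ℕ} (hN : N ≠ 0) (w : InfSeries) :
    eval₂ (HahnSeries.C : ℂ →+* InfSeries)
      ![InfSeries.X, HahnSeries.single (-(k / n : ℚ)) 1 * w] g =
    HahnSeries.single (-(M / n : ℚ)) 1 * (((g.edgeLift n k M).map
      (PowerSeries.expand N hN : PowerSeries ℂ →ₐ[ℂ] PowerSeries ℂ).toRingHom).map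
        (puiseuxHom (n * N) (mul_ne_zero hn hN))).eval w := by
  rw [eval₂_eq', edgeLift, Polynomial.map_sum, Polynomial.map_sum, Polynomial.eval_finsetSum,
    Finset.mul_sum]
  refine Finset.sum_congr rfl fun m hm => ?_
  obtain ⟨d, hd⟩ := Nat.exists_eq_add_of_le (hM m hm)
  have hd' : M - (n * m 0 + k * m 1) = d := by omega
  have hn' : (n : ℚ) ≠ 0 := by exact_mod_cast hn
  have hN' : (N : ℚ) ≠ 0 := by exact_mod_cast hN
  rw [Polynomial.map_monomial, Polynomial.map_monomial, Polynomial.eval_monomial, hd']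
  simp only [AlgHom.toRingHom_eq_coe, RingHom.coe_coe, map_mul, map_pow, PowerSeries.expand_C,
    PowerSeries.expand_X, puiseuxHom_C, puiseuxHom_X, Fin.prod_univ_two, Matrix.cons_val_zero,
    Matrix.cons_val_one, InfSeries.X, mul_pow, HahnSeries.single_pow, one_pow]
  have e : (HahnSeries.single (m 0 • (-1 : ℚ)) (1 : ℂ) : InfSeries) *
      HahnSeries.single (m 1 • (-(k / n : ℚ))) 1 = HahnSeries.single (-(M / n : ℚ)) 1 *
      HahnSeries.single (d • N • (1 / (n * N : ℕ) : ℚ)) 1 := by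
    rw [HahnSeries.single_mul_single, HahnSeries.single_mul_single]
    congr 1
    rw [hd]
    push_cast
    simp only [nsmul_eq_mul]
    field_simp
    ring_nf
  linear_combination HahnSeries.C (coeff m g) * w ^ m 1 * e

/-- A root of the edge polynomial is the leading coefficient of a Puiseux series. -/
theorem exists_isPuiseux_of_isRoot_edgePolynomial (hn : n ≠ 0)
    (hM : ∀ m ∈ g.support, n * m 0 + k * m 1 ≤ M) (h0 : g.edgePolynomial n k M ≠ 0) {a : ℂ}
    (ha : (g.edgePolynomial n k M).IsRoot a) :
    ∃ s : InfSeries, s.IsPuiseux ∧ (∀ r : ℚ, s.xcoeff r ≠ 0 → r < k / n) ∧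
      eval₂ (HahnSeries.C : ℂ →+* InfSeries)
        ![InfSeries.X, HahnSeries.single (-(k / n : ℚ)) a + s] g = 0 := by
  have htay : (Polynomial.taylor (PowerSeries.C a) (g.edgeLift n k M)).map
      PowerSeries.constantCoeff = Polynomial.taylor a (g.edgePolynomial n k M) := by
    rw [← map_edgeLift hM, Polynomial.taylor_apply, Polynomial.map_comp]
    simp [Polynomial.taylor_apply]
  obtain ⟨N, hN, z, hz0, hz⟩ := PowerSeries.exists_isRoot_expand
    ((g.edgePolynomial n k M).rootMultiplicity a)
    (Polynomial.taylor (PowerSeries.C a) (g.edgeLift n k M))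
    ((Polynomial.rootMultiplicity_pos h0).2 ha)
    (by
      intro j hj
      rw [← Polynomial.coeff_map, htay]
      exact Polynomial.coeff_taylor_eq_zero_of_lt_rootMultiplicity _ _ hj)
    (by
      rw [← Polynomial.coeff_map, htay]
      exact Polynomial.coeff_taylor_rootMultiplicity_ne_zero h0 a)
  have hz' : ((g.edgeLift n k M).map (PowerSeries.expand N hN :
      PowerSeries ℂ →ₐ[ℂ] PowerSeries ℂ).toRingHom).eval (z + PowerSeries.C a) = 0 := by
    rw [Polynomial.IsRoot, Polynomial.taylor_apply, Polynomial.map_comp] at hz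
    simpa [Polynomial.eval_comp, PowerSeries.expand_C] using hz
  have hn' : (0 : ℚ) < n := by exact_mod_cast Nat.pos_of_ne_zero hn
  have hN' : (0 : ℚ) < N := by exact_mod_cast Nat.pos_of_ne_zero hN
  have hs : ∀ r : ℚ, InfSeries.xcoeff (HahnSeries.single (-(k / n : ℚ)) 1 *
      puiseuxHom (n * N) (mul_ne_zero hn hN) z) r ≠ 0 →
      ∃ l : ℕ, -r + k / n = l / (n * N : ℕ) ∧ l ≠ 0 := by
    intro r hr
    rw [InfSeries.xcoeff, HahnSeries.coeff_single_mul, one_mul] at hr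
    obtain ⟨l, hl, hl'⟩ := exists_of_coeff_puiseuxHom_ne_zero hr
    refine ⟨l, by rw [← hl, sub_neg_eq_add], ?_⟩
    rintro rfl
    exact hl' (by rwa [PowerSeries.coeff_zero_eq_constantCoeff_apply])
  -- The remainder is `x ^ (k / n)` times a series without constant term, so its exponents lie below
  -- `k / n`.
  refine ⟨HahnSeries.single (-(k / n : ℚ)) 1 * puiseuxHom (n * N) (mul_ne_zero hn hN) z,
    ⟨n * N, by positivity, ?_⟩, ?_, ?_⟩
  · intro r hr
    obtain ⟨l, hl, -⟩ := hs r hr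
    refine ⟨k * N - l, ?_⟩
    have : r = k / n - l / (n * N : ℕ) := by linarith
    rw [this]
    push_cast
    field_simp
  · intro r hr
    obtain ⟨l, hl, hl0⟩ := hs r hr
    have : (0 : ℚ) < l / (n * N : ℕ) := by
      have : (0 : ℚ) < l := by exact_mod_cast Nat.pos_of_ne_zero hl0
      push_cast; positivity
    linarith
  · have e : (HahnSeries.single (-(k / n : ℚ)) a : InfSeries) +
        HahnSeries.single (-(k / n : ℚ)) 1 * puiseuxHom (n * N) (mul_ne_zero hn hN) z =
        HahnSeries.single (-(k / n : ℚ)) 1 *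
          puiseuxHom (n * N) (mul_ne_zero hn hN) (z + PowerSeries.C a) := by
      rw [map_add, puiseuxHom_C, mul_add, HahnSeries.C_apply, HahnSeries.single_mul_single,
        add_zero, one_mul, add_comm]
    rw [e, eval₂_eq_edgeLift hn hM hN, Polynomial.eval_map, Polynomial.eval₂_hom, hz', map_zero,
      mul_zero]

theorem edgePolynomial_totalDegree_ne_zero (hg : g ≠ 0) :
    g.edgePolynomial 1 1 g.totalDegree ≠ 0 := by
  obtain ⟨m, hm, hdeg⟩ := Finset.exists_mem_eq_sup g.support (support_nonempty.2 hg)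
    (fun m => m.sum fun _ e => e)
  have h : 1 * m 0 + 1 * m 1 = g.totalDegree := by
    rw [totalDegree, hdeg, Finsupp.sum_fintype _ _ (fun _ => rfl), Fin.sum_univ_two]
    simp
  intro h0
  have := coeff_edgePolynomial (g := g) one_ne_zero h
  rw [h0, Polynomial.coeff_zero] at this
  exact mem_support_iff.1 hm this.symm

theorem add_le_totalDegree_of_mem_support {m : Fin 2 →₀ ℕ} (hm : m ∈ g.support) :
    m 0 + m 1 ≤ g.totalDegree := by
  have := le_totalDegree hm
  rwa [Finsupp.sum_fintype _ _ (fun _ => rfl), Fin.sum_univ_two] at this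

/-- With `y = x w` the solutions become roots of a one-variable polynomial over a field. It is
non-zero because it reduces to the dehomogenized form of top degree. -/
theorem finite_setOf_eval₂_X_eq_zero (hg : g ≠ 0) :
    {y : InfSeries | eval₂ (HahnSeries.C : ℂ →+* InfSeries) ![InfSeries.X, y] g = 0}.Finite := by
  have hM : ∀ m ∈ g.support, 1 * m 0 + 1 * m 1 ≤ g.totalDegree := fun m hm => by
    simpa using add_le_totalDegree_of_mem_support hm
  set Q := ((g.edgeLift 1 1 g.totalDegree).map (PowerSeries.expand 1 one_ne_zero :
    PowerSeries ℂ →ₐ[ℂ] PowerSeries ℂ).toRingHom).map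
    (puiseuxHom (1 * 1) (mul_ne_zero one_ne_zero one_ne_zero)) with hQ
  have hinj : Function.Injective (puiseuxHom (1 * 1) (mul_ne_zero one_ne_zero one_ne_zero)) := by
    rw [injective_iff_map_eq_zero]
    intro z hz
    ext k
    rw [← coeff_puiseuxHom (1 * 1) (by simp) z k, hz]
    simp
  have hQ0 : Q ≠ 0 := by
    rw [hQ, Ne, Polynomial.map_eq_zero_iff hinj, PowerSeries.expand_one]
    intro h
    have h2 := edgePolynomial_totalDegree_ne_zero hg
    have h3 : (g.edgeLift 1 1 g.totalDegree) = 0 := by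
      rw [← h]
      exact Polynomial.map_id.symm
    rw [← map_edgeLift hM, h3, Polynomial.map_zero] at h2
    exact h2 rfl
  refine Set.Finite.subset ((Q.finite_setOfPred_isRoot hQ0).image
    (fun w => HahnSeries.single (-1 : ℚ) (1 : ℂ) * w)) ?_
  intro y hy
  refine ⟨HahnSeries.single (1 : ℚ) (1 : ℂ) * y, ?_, ?_⟩
  · have e : (HahnSeries.single (-((1 : ℕ) / (1 : ℕ) : ℚ)) 1 : InfSeries) *
        (HahnSeries.single (1 : ℚ) (1 : ℂ) * y) = y := by
      rw [← mul_assoc, HahnSeries.single_mul_single]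
      simp
    have := eval₂_eq_edgeLift (g := g) one_ne_zero hM one_ne_zero
      (HahnSeries.single (1 : ℚ) (1 : ℂ) * y)
    rw [e] at this
    rw [Set.mem_ofPred_eq, this] at hy
    refine (mul_eq_zero.1 hy).resolve_left ?_
    simp
  · change HahnSeries.single (-1 : ℚ) (1 : ℂ) * _ = _
    rw [← mul_assoc, HahnSeries.single_mul_single]
    simp

end MvPolynomial

/-! ### Leading terms of series at infinity -/

namespace InfSeries

/-- The series has no exponents above `r`, and the coefficient `a` at `x ^ r`. -/
def LeadsWith (s : InfSeries) (r : ℚ) (a : ℂ) : Prop :=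
  s.xcoeff r = a ∧ ∀ r' > r, s.xcoeff r' = 0

/-- Every pair of exponents with sum at least `r + r'`, other than `(r, r')`, has a member beyond
its leading exponent. The leading coefficients may be zero. -/
theorem LeadsWith.mul {s s' : InfSeries} {r r' : ℚ} {a a' : ℂ} (h : s.LeadsWith r a)
    (h' : s'.LeadsWith r' a') : (s * s').LeadsWith (r + r') (a * a') := by
  have key : ∀ i j : ℚ, -r - r' ≥ i + j → (i, j) ≠ (-r, -r') →
      s.coeff i * s'.coeff j = 0 := by
    intro i j hij hne
    rcases lt_trichotomy i (-r) with hi | hi | hi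
    · have := h.2 (-i) (by linarith)
      rw [xcoeff, neg_neg] at this
      rw [this, zero_mul]
    · have hj : j < -r' := by
        refine lt_of_le_of_ne (by linarith) ?_
        rintro rfl
        exact hne (by rw [hi])
      have := h'.2 (-j) (by linarith)
      rw [xcoeff, neg_neg] at this
      rw [this, mul_zero]
    · have := h'.2 (-j) (by linarith)
      rw [xcoeff, neg_neg] at this
      rw [this, mul_zero]
  constructor
  · rw [xcoeff, HahnSeries.coeff_mul, Finset.sum_eq_single (-r, -r')]
    · rw [← h.1, ← h'.1]; rfl
    · rintro ⟨i, j⟩ hij hne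
      rw [Finset.mem_antidiagonal] at hij
      exact key i j (by linarith [hij.2.2]) hne
    · intro hn
      rw [Finset.mem_antidiagonal] at hn
      by_contra h0
      refine hn ⟨left_ne_zero_of_mul h0, right_ne_zero_of_mul h0, ?_⟩
      ring
  · intro r'' hr''
    rw [xcoeff, HahnSeries.coeff_mul]
    refine Finset.sum_eq_zero ?_
    rintro ⟨i, j⟩ hij
    rw [Finset.mem_antidiagonal] at hij
    have h2 : i + j = -r'' := hij.2.2
    refine key i j (by linarith) ?_
    rintro ⟨⟩
    linarith

theorem leadsWith_C (a : ℂ) : LeadsWith (HahnSeries.C a) 0 a := by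
  constructor
  · simp [xcoeff]
  · intro r hr
    rw [xcoeff, HahnSeries.C_apply, HahnSeries.coeff_single_of_ne]
    linarith

theorem leadsWith_X : LeadsWith X 1 1 := by
  constructor
  · simp [xcoeff, X]
  · intro r hr
    rw [xcoeff, X, HahnSeries.coeff_single_of_ne]
    linarith

theorem LeadsWith.pow {s : InfSeries} {r : ℚ} {a : ℂ} (h : s.LeadsWith r a) (j : ℕ) :
    (s ^ j).LeadsWith (j * r) (a ^ j) := by
  induction j with
  | zero => simpa using leadsWith_C 1
  | succ j ih =>
    rw [pow_succ, pow_succ]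
    convert ih.mul h using 1
    push_cast; ring

end InfSeries

/-! ### Expansions of leading exponent `1 / p` and the drop of the degree -/

namespace MvPolynomial

variable {f : MvPolynomial (Fin 2) ℂ}

/-- Replacing `x` by `-c y ^ p` alone gives a polynomial in `y` of degree at most `N`, whose
coefficient at `y ^ N` is the sum in `h0`. The error has smaller degree, since it trades a factor `y
^ p` for a factor `x` and `p > 1`. -/
theorem totalDegree_triangularHom_lt {p N : ℕ} (hp : 1 < p) (hN : 0 < N) (c : ℂ)
    (hle : ∀ m ∈ f.support, p * m 0 + m 1 ≤ N)
    (h0 : ∑ m ∈ f.support with p * m 0 + m 1 = N, f.coeff m * (-c) ^ m 0 = 0) :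
    (triangularHom c p f).totalDegree < N := by
  suffices h : triangularHom c p f ∈ restrictTotalDegree (Fin 2) ℂ (N - 1) by
    rw [mem_restrictTotalDegree] at h
    omega
  set A : MvPolynomial (Fin 2) ℂ := X 0 - C c * X 1 ^ p with hA
  set B : MvPolynomial (Fin 2) ℂ := C (-c) * X 1 ^ p with hB
  have hAB : A - B = X 0 := by rw [hA, hB, C_neg]; ring
  have hBdeg : B.totalDegree ≤ p := by
    refine (totalDegree_mul _ _).trans ?_
    rw [totalDegree_C, zero_add, totalDegree_X_pow]
  have hAdeg : A.totalDegree ≤ p := by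
    rw [← sub_add_cancel A B, hAB]
    refine (totalDegree_add _ _).trans (max_le ?_ hBdeg)
    rw [totalDegree_X]; exact hp.le
  have hf : triangularHom c p f = (∑ m ∈ f.support, C (f.coeff m) * (A ^ m 0 - B ^ m 0) *
      X 1 ^ m 1) + ∑ m ∈ f.support, C (f.coeff m) * B ^ m 0 * X 1 ^ m 1 := by
    rw [← Finset.sum_add_distrib, triangularHom, aeval_def, eval₂_eq']
    refine Finset.sum_congr rfl fun m _ => ?_
    rw [Fin.prod_univ_two]
    simp only [Matrix.cons_val_zero, Matrix.cons_val_one, algebraMap_eq]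
    ring
  rw [hf]
  refine Submodule.add_mem _ (Submodule.sum_mem _ fun m hm => ?_) ?_
  · rw [mem_restrictTotalDegree]
    rcases Nat.eq_zero_or_pos (m 0) with h | h
    · simp [h]
    -- `A ^ i - B ^ i` is `A - B = x` times a sum of products of `i - 1` factors of degree at most
    -- `p`.
    · have h1 : (A ^ m 0 - B ^ m 0).totalDegree ≤ 1 + p * (m 0 - 1) := by
        rw [← (Commute.all A B).mul_geom_sum₂ (m 0), hAB]
        refine (totalDegree_mul _ _).trans (add_le_add (totalDegree_X (R := ℂ) (0 : Fin 2)).le ?_)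
        refine (totalDegree_finsetSum _ _).trans (Finset.sup_le fun l hl => ?_)
        refine (totalDegree_mul _ _).trans ?_
        have hl' := Finset.mem_range.1 hl
        calc (A ^ l).totalDegree + (B ^ (m 0 - 1 - l)).totalDegree
            ≤ l * p + (m 0 - 1 - l) * p :=
              add_le_add ((totalDegree_pow _ _).trans (Nat.mul_le_mul_left _ hAdeg))
                ((totalDegree_pow _ _).trans (Nat.mul_le_mul_left _ hBdeg))
          _ = p * (m 0 - 1) := by
              rw [← add_mul, mul_comm]
              congr 1
              omega
      have h2 : (C (f.coeff m) * (A ^ m 0 - B ^ m 0) * X 1 ^ m 1).totalDegree ≤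
          0 + (1 + p * (m 0 - 1)) + m 1 := by
        refine (totalDegree_mul _ _).trans (add_le_add ((totalDegree_mul _ _).trans
          (add_le_add (totalDegree_C (σ := Fin 2) _).le h1)) ?_)
        rw [totalDegree_X_pow]
      have h3 := hle m hm
      obtain ⟨i, hi⟩ := Nat.exists_eq_add_of_lt h
      rw [hi] at h2 h3 ⊢
      have h4 : p * (0 + i + 1) = p * (0 + i + 1 - 1) + p := by simp; ring
      omega
  · have hmon : ∀ m ∈ f.support, C (f.coeff m) * B ^ m 0 * X 1 ^ m 1 =
        monomial (Finsupp.single 1 (p * m 0 + m 1)) (f.coeff m * (-c) ^ m 0) := by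
      intro m _
      rw [monomial_eq, Finsupp.prod_single_index (by simp), hB, mul_pow, ← pow_mul, pow_add,
        C_mul, C_pow]
      ring
    rw [Finset.sum_congr rfl hmon,
      ← Finset.sum_filter_add_sum_filter_not _ (fun m => p * m 0 + m 1 = N)]
    refine Submodule.add_mem _ ?_ (Submodule.sum_mem _ fun m hm => ?_)
    · have : ∑ m ∈ f.support with p * m 0 + m 1 = N,
          monomial (Finsupp.single (1 : Fin 2) (p * m 0 + m 1)) (f.coeff m * (-c) ^ m 0) =
          monomial (Finsupp.single 1 N) (∑ m ∈ f.support with p * m 0 + m 1 = N,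
            f.coeff m * (-c) ^ m 0) := by
        rw [map_sum]
        refine Finset.sum_congr rfl fun m hm => ?_
        rw [(Finset.mem_filter.1 hm).2]
      rw [this, h0, map_zero]
      exact Submodule.zero_mem _
    · rw [mem_restrictTotalDegree]
      refine (totalDegree_monomial_le _ _).trans ?_
      rw [Finset.mem_filter] at hm
      have := hle m hm.1
      rw [Finsupp.sum_single_index rfl, id_eq]
      omega

theorem coeff_sub_C_of_ne {m : Fin 2 →₀ ℕ} (hm : m ≠ 0) (c : ℂ) :
    (f - C c).coeff m = f.coeff m := by
  rw [coeff_sub, coeff_C, if_neg hm.symm, sub_zero]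

theorem mem_support_sub_C {m : Fin 2 →₀ ℕ} (hm : m ≠ 0) (c : ℂ) :
    m ∈ (f - C c).support ↔ m ∈ f.support := by
  rw [mem_support_iff, mem_support_iff, coeff_sub_C_of_ne hm]

theorem mem_puiseuxAt_some_iff {c β : ℂ} {s : InfSeries} : s ∈ f.puiseuxAt c (some β) ↔
    s.IsPuiseux ∧ (∀ r : ℚ, s.xcoeff r ≠ 0 → r < 1) ∧
      eval₂ (HahnSeries.C : ℂ →+* InfSeries) ![InfSeries.X, HahnSeries.C β * InfSeries.X + s]
        (f - C c) = 0 := by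
  rw [eval₂_sub, eval₂_C, sub_eq_zero]
  rfl

theorem mem_puiseuxAt_none_iff {c : ℂ} {s : InfSeries} : s ∈ f.puiseuxAt c none ↔
    s.IsPuiseux ∧ (∀ r : ℚ, s.xcoeff r ≠ 0 → r < 1) ∧
      eval₂ (HahnSeries.C : ℂ →+* InfSeries) ![InfSeries.X, s]
        (rename (Equiv.swap 0 1) (f - C c)) = 0 := by
  have : (![InfSeries.X, s] : Fin 2 → InfSeries) ∘ (Equiv.swap 0 1) = ![s, InfSeries.X] := by
    ext1 i; fin_cases i <;> simp
  rw [eval₂_rename, this, eval₂_sub, eval₂_C, sub_eq_zero]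
  rfl

theorem sub_C_ne_zero (hf : 0 < f.totalDegree) (c : ℂ) : f - C c ≠ 0 := by
  intro h
  rw [sub_eq_zero] at h
  rw [h, totalDegree_C] at hf
  exact hf.false

theorem totalDegree_sub_C (hf : 0 < f.totalDegree) (c : ℂ) :
    (f - C c).totalDegree = f.totalDegree := by
  rw [sub_eq_add_neg, ← C_neg]
  exact totalDegree_add_eq_left_of_totalDegree_lt (by rwa [totalDegree_C])

theorem finite_puiseuxAt (hf : 0 < f.totalDegree) (c : ℂ) (P : Option ℂ) :
    (f.puiseuxAt c P).Finite := by
  have hg := sub_C_ne_zero hf c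
  rcases P with _ | β
  · refine (finite_setOf_eval₂_X_eq_zero (g := rename (Equiv.swap 0 1) (f - C c)) ?_).subset
      fun s hs => (mem_puiseuxAt_none_iff.1 hs).2.2
    exact fun h => hg (rename_injective _ (Equiv.injective _) (by rw [h, map_zero]))
  · refine Set.Finite.of_finite_image (f := fun s => HahnSeries.C β * InfSeries.X + s)
      ((finite_setOf_eval₂_X_eq_zero hg).subset ?_) (fun a _ b _ h => add_left_cancel h)
    rintro _ ⟨s, hs, rfl⟩
    exact (mem_puiseuxAt_some_iff.1 hs).2.2

theorem puiseuxAt_some_nonempty (hf : 0 < f.totalDegree) {c β : ℂ}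
    (hβ : ((f - C c).edgePolynomial 1 1 f.totalDegree).IsRoot β) :
    (f.puiseuxAt c (some β)).Nonempty := by
  have hdeg := totalDegree_sub_C hf c
  have h0 := edgePolynomial_totalDegree_ne_zero (sub_C_ne_zero hf c)
  rw [hdeg] at h0
  obtain ⟨s, hs, hs1, hs2⟩ := exists_isPuiseux_of_isRoot_edgePolynomial one_ne_zero
    (fun m hm => by simpa [hdeg] using add_le_totalDegree_of_mem_support hm) h0 hβ
  refine ⟨s, mem_puiseuxAt_some_iff.2 ⟨hs, fun r hr => by simpa using hs1 r hr, ?_⟩⟩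
  rw [← hs2]
  simp [InfSeries.X, HahnSeries.C_apply]

/-- Without `y ^ N` in the form of top degree, `[0 : 1]` lies at infinity. Exchanging the variables
reduces this to the root `0` of an edge polynomial. -/
theorem puiseuxAt_none_nonempty (hf : 0 < f.totalDegree) {c : ℂ}
    (h : ((f - C c).edgePolynomial 1 1 f.totalDegree).coeff f.totalDegree = 0) :
    (f.puiseuxAt c none).Nonempty := by
  set g := rename (Equiv.swap (0 : Fin 2) 1) (f - C c) with hg
  have hg0 : g ≠ 0 := fun h0 => sub_C_ne_zero hf c
    (rename_injective _ (Equiv.injective _) (by rw [← hg, h0, map_zero]))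
  have hdeg : g.totalDegree = f.totalDegree := by
    rw [hg, ← totalDegree_sub_C hf c]
    exact totalDegree_renameEquiv (Equiv.swap 0 1) (f - C c)
  have h0 := edgePolynomial_totalDegree_ne_zero hg0
  have hroot : (g.edgePolynomial 1 1 g.totalDegree).IsRoot 0 := by
    have h1 := coeff_edgePolynomial (g := g) (k := 1) (M := f.totalDegree) one_ne_zero
      (m := Finsupp.single 0 f.totalDegree) (by simp)
    have h2 := coeff_edgePolynomial (g := f - C c) (k := 1) (M := f.totalDegree) one_ne_zero
      (m := Finsupp.single 1 f.totalDegree) (by simp)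
    have h3 := coeff_rename_mapDomain (Equiv.swap (0 : Fin 2) 1) (Equiv.injective _) (f - C c)
      (Finsupp.single 1 f.totalDegree)
    rw [Finsupp.mapDomain_single, Equiv.swap_apply_right, ← hg] at h3
    rw [Polynomial.IsRoot, ← Polynomial.coeff_zero_eq_eval_zero, hdeg]
    simp only [Finsupp.single_eq_same] at h2
    rw [h3, ← h2, h] at h1
    simpa using h1
  obtain ⟨s, hs, hs1, hs2⟩ := exists_isPuiseux_of_isRoot_edgePolynomial one_ne_zero
    (fun m hm => by simpa using add_le_totalDegree_of_mem_support hm) h0 hroot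
  refine ⟨s, mem_puiseuxAt_none_iff.2 ⟨hs, fun r hr => by simpa using hs1 r hr, ?_⟩⟩
  rw [← hs2]
  simp [hg]

theorem IsPointAtInfinity.isRoot_edgePolynomial (hf : 0 < f.totalDegree)
    (hpos : f.IsPointAtInfinity 1 0) (c : ℂ) :
    ((f - C c).edgePolynomial 1 1 f.totalDegree).IsRoot 0 := by
  have h1 := coeff_edgePolynomial (g := f - C c) (k := 1) (M := f.totalDegree) one_ne_zero
    (m := Finsupp.single 0 f.totalDegree) (by simp)
  have hne : (Finsupp.single 0 f.totalDegree : Fin 2 →₀ ℕ) ≠ 0 := by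
    simpa using hf.ne'
  rw [coeff_sub_C_of_ne hne] at h1
  have h2 := hpos.2
  rw [eval_eq', Finset.sum_eq_single (Finsupp.single 0 f.totalDegree)] at h2
  · rw [Polynomial.IsRoot, ← Polynomial.coeff_zero_eq_eval_zero]
    simp only [coeff_homogeneousComponent, Fin.prod_univ_two] at h2
    simp at h2 h1
    rw [h1, h2]
  · intro m hm hne
    rw [Fin.prod_univ_two]
    have : m 1 ≠ 0 := by
      intro h
      apply hne
      rw [mem_support_iff, coeff_homogeneousComponent] at hm
      have hd : m.degree = f.totalDegree := by
        by_contra h'; exact hm (if_neg h')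
      rw [Finsupp.degree_eq_sum, Fin.sum_univ_two, h] at hd
      ext i; fin_cases i
      · simpa using hd
      · simpa using h
    simp [this]
  · intro hn
    rw [notMem_support_iff.1 hn, zero_mul]

/-- As `[1 : 0]` is the only point at infinity, the form of top degree is a multiple of `y ^ N`. If
a monomial violated the bound, the edge of the Newton polygon that leaves `y ^ N` would have slope
`k / n > 1 / p`. Its edge polynomial has two terms, hence a non-zero root, and this starts an
expansion with exponent `k / n`, against `hle`. -/
theorem weight_le_of_puiseuxAt (hf : 0 < f.totalDegree) (c : ℂ)
    {p : ℕ} (huniq : ∀ P, (f.puiseuxAt c P).Nonempty → P = some 0)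
    (hle : ∀ s ∈ f.puiseuxAt c (some 0), ∀ r : ℚ, 1 / p < r → s.xcoeff r = 0) (hp : 0 < p) :
    ∀ m ∈ f.support, p * m 0 + m 1 ≤ f.totalDegree := by
  set N := f.totalDegree with hN
  have hne : ∀ {m : Fin 2 →₀ ℕ} {i : Fin 2}, m i ≠ 0 → m ≠ 0 := by
    rintro m i h rfl; simp at h
  have hcN : ((f - C c).edgePolynomial 1 1 N).coeff N ≠ 0 := by
    intro h
    simpa using huniq none (puiseuxAt_none_nonempty hf h)
  have hcj : ∀ j, j ≠ N → ((f - C c).edgePolynomial 1 1 N).coeff j = 0 := by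
    intro j hj
    by_contra h
    obtain ⟨a, ha, hroot⟩ := Polynomial.exists_isRoot_ne_zero_of_coeff_ne_zero _ hj h hcN
    have := huniq (some a) (puiseuxAt_some_nonempty hf hroot)
    exact ha (by simpa using this)
  have hlt : ∀ m ∈ f.support, m 0 ≠ 0 → m 0 + m 1 < N := by
    intro m hm hm0
    refine lt_of_le_of_ne (add_le_totalDegree_of_mem_support hm) fun h => ?_
    have h1 := hcj (m 1) (by omega)
    rw [coeff_edgePolynomial one_ne_zero (by omega), coeff_sub_C_of_ne (hne hm0)] at h1
    exact mem_support_iff.1 hm h1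
  have hfN : (f - C c).coeff (Finsupp.single 1 N) ≠ 0 := by
    rw [← coeff_edgePolynomial (k := 1) (M := N) one_ne_zero (by simp)]
    simpa using hcN
  intro m hm
  by_contra! hgt
  have hm0 : m 0 ≠ 0 := by
    intro h
    have := add_le_totalDegree_of_mem_support hm
    rw [h, mul_zero] at hgt
    omega
  -- The other end of the edge: the monomial `x ^ i y ^ j` with `i ≠ 0` that maximizes `i / (N -
  -- j)`. Below, `k / n` is this maximum.
  obtain ⟨m', hm', hmax⟩ := Finset.exists_max_image (f.support.filter fun m => m 0 ≠ 0)
    (fun m => (m 0 : ℚ) / (N - m 1 : ℕ)) ⟨m, Finset.mem_filter.2 ⟨hm, hm0⟩⟩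
  rw [Finset.mem_filter] at hm'
  have hlt' := hlt m' hm'.1 hm'.2
  obtain ⟨n, hn⟩ : ∃ n, n = N - m' 1 := ⟨_, rfl⟩
  obtain ⟨k, hk⟩ : ∃ k, k = m' 0 := ⟨_, rfl⟩
  have hn0 : n ≠ 0 := by omega
  have hnQ : (0 : ℚ) < n := by exact_mod_cast Nat.pos_of_ne_zero hn0
  have hcross : ∀ m ∈ f.support, m 0 ≠ 0 → n * m 0 ≤ k * (N - m 1) := by
    intro m hm hm0
    have h1 := hmax m (Finset.mem_filter.2 ⟨hm, hm0⟩)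
    have h2 := hlt m hm hm0
    rw [← hn, ← hk, div_le_div_iff₀ (by exact_mod_cast (by omega : 0 < N - m 1)) hnQ] at h1
    rw [mul_comm]
    exact_mod_cast h1
  have hM : ∀ m ∈ (f - C c).support, n * m 0 + k * m 1 ≤ k * N := by
    intro m hm
    by_cases h0 : m = 0
    · simp [h0]
    rw [mem_support_sub_C h0] at hm
    have h3 := add_le_totalDegree_of_mem_support hm
    by_cases h1 : m 0 = 0
    · rw [h1, mul_zero, zero_add]
      exact Nat.mul_le_mul_left _ (by omega)
    · have h2 := hcross m hm h1
      obtain ⟨d, hd⟩ := Nat.exists_eq_add_of_le (show m 1 ≤ N by omega)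
      rw [hd, Nat.add_sub_cancel_left] at h2
      rw [hd, mul_add]
      omega
  have hE1 : ((f - C c).edgePolynomial n k (k * N)).coeff N ≠ 0 := by
    have := coeff_edgePolynomial (g := f - C c) (k := k) (M := k * N) hn0
      (m := Finsupp.single 1 N) (by simp)
    rw [Finsupp.single_eq_same] at this
    rwa [this]
  have hE2 : ((f - C c).edgePolynomial n k (k * N)).coeff (m' 1) ≠ 0 := by
    rw [coeff_edgePolynomial hn0, coeff_sub_C_of_ne (hne hm'.2)]
    · exact mem_support_iff.1 hm'.1
    · rw [← hk, mul_comm, ← mul_add]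
      congr 1
      omega
  obtain ⟨a, ha, hroot⟩ := Polynomial.exists_isRoot_ne_zero_of_coeff_ne_zero _ (by omega) hE1 hE2
  obtain ⟨s, ⟨d, hd, hsd⟩, hs1, hs2⟩ := exists_isPuiseux_of_isRoot_edgePolynomial hn0 hM
    (by rintro h; rw [h] at hE1; simp at hE1) hroot
  have hxc : ∀ r, InfSeries.xcoeff (HahnSeries.single (-(k / n : ℚ)) a + s) r =
      (if r = k / n then a else 0) + s.xcoeff r := by
    intro r
    rw [InfSeries.xcoeff, HahnSeries.coeff_add, HahnSeries.coeff_single]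
    simp only [neg_inj]
    rfl
  have hkn : (k / n : ℚ) < 1 := by
    rw [div_lt_one hnQ]
    exact_mod_cast (by omega : k < n)
  have hmem : HahnSeries.single (-(k / n : ℚ)) a + s ∈ f.puiseuxAt c (some 0) := by
    rw [mem_puiseuxAt_some_iff]
    refine ⟨⟨d * n, by positivity, ?_⟩, ?_, ?_⟩
    · intro r hr
      rw [hxc] at hr
      by_cases h : r = k / n
      · refine ⟨d * k, ?_⟩
        rw [h]; push_cast; field_simp
      · rw [if_neg h, zero_add] at hr
        obtain ⟨l, hl⟩ := hsd r hr
        refine ⟨n * l, ?_⟩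
        push_cast
        rw [← hl]; ring
    · intro r hr
      rw [hxc] at hr
      by_cases h : r = k / n
      · rwa [h]
      · rw [if_neg h, zero_add] at hr
        exact (hs1 r hr).trans hkn
    · rw [← hs2]; simp
  have hcoef := hle _ hmem (k / n) (by
    have h1 := hcross m hm hm0
    have h2 := hlt m hm hm0
    have h3 : N - m 1 < p * m 0 := by omega
    have h4 : n < p * k := by
      have h5 : n * (N - m 1) < p * k * (N - m 1) :=
        calc n * (N - m 1) < n * (p * m 0) := Nat.mul_lt_mul_of_pos_left h3 (by omega)
          _ = p * (n * m 0) := by ring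
          _ ≤ p * (k * (N - m 1)) := Nat.mul_le_mul_left _ h1
          _ = p * k * (N - m 1) := by ring
      exact lt_of_mul_lt_mul_right h5 (Nat.zero_le _)
    rw [div_lt_div_iff₀ (by exact_mod_cast hp) hnQ, one_mul, mul_comm]
    exact_mod_cast h4)
  rw [hxc, if_pos rfl] at hcoef
  have : s.xcoeff (k / n) = 0 := by
    by_contra h
    exact (hs1 _ h).false
  rw [this, add_zero] at hcoef
  exact ha hcoef

/-- If all fibre points at infinity lie at `[1 : 0]`, with expansions of leading exponent `1 / p`,
then a triangular automorphism lowers the degree. -/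
theorem exists_totalDegree_triangularAut_lt (hf : 0 < f.totalDegree) (c : ℂ) {p : ℕ} (hp : 1 < p)
    (huniq : ∀ P, (f.puiseuxAt c P).Nonempty → P = some 0)
    (hle : ∀ s ∈ f.puiseuxAt c (some 0), ∀ r : ℚ, 1 / p < r → s.xcoeff r = 0)
    (hex : ∃ s ∈ f.puiseuxAt c (some 0), s.xcoeff (1 / p) ≠ 0) :
    ∃ c' : ℂ, (triangularAut c' p f).totalDegree < f.totalDegree := by
  have hwt := weight_le_of_puiseuxAt hf c huniq hle (by omega)
  obtain ⟨s, hs, ha⟩ := hex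
  obtain ⟨a, rfl⟩ : ∃ a, a = s.xcoeff (1 / p) := ⟨_, rfl⟩
  have hlead : s.LeadsWith (1 / p) (s.xcoeff (1 / p)) := ⟨rfl, hle s hs⟩
  generalize s.xcoeff (1 / p) = a at *
  have hpQ : (0 : ℚ) < p := by exact_mod_cast (by omega : 0 < p)
  -- Only monomials of weight `N` reach the exponent `N / p`, so the coefficient there of `f - c`
  -- along `s` is the form of weight `N` at `(1, a)`.
  have hterm : ∀ m ∈ (f - C c).support, InfSeries.xcoeff (HahnSeries.C ((f - C c).coeff m) *
      (InfSeries.X ^ m 0 * s ^ m 1)) (f.totalDegree / p) =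
      if p * m 0 + m 1 = f.totalDegree then (f - C c).coeff m * a ^ m 1 else 0 := by
    intro m hm
    have h1 := (InfSeries.leadsWith_C ((f - C c).coeff m)).mul
      ((InfSeries.leadsWith_X.pow (m 0)).mul (hlead.pow (m 1)))
    have e : (0 + ((m 0 : ℚ) * 1 + m 1 * (1 / p))) = (p * m 0 + m 1 : ℕ) / p := by
      push_cast; field_simp; ring
    rw [e, one_pow, one_mul] at h1
    split_ifs with h
    · rw [← h]; exact h1.1
    · apply h1.2
      have h2 : p * m 0 + m 1 ≤ f.totalDegree := by
        by_cases h0 : m = 0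
        · simp [h0]
        · exact hwt m ((mem_support_sub_C h0 c).1 hm)
      exact div_lt_div_of_pos_right (by exact_mod_cast lt_of_le_of_ne h2 h) hpQ
  have hsum : ∑ m ∈ (f - C c).support with p * m 0 + m 1 = f.totalDegree,
      (f - C c).coeff m * a ^ m 1 = 0 := by
    have h := (mem_puiseuxAt_some_iff.1 hs).2.2
    rw [HahnSeries.C_zero, zero_mul, zero_add, eval₂_eq'] at h
    have h' := congrArg (fun t : InfSeries => t.xcoeff (f.totalDegree / p)) h
    simp only [Fin.prod_univ_two, Matrix.cons_val_zero, Matrix.cons_val_one, InfSeries.xcoeff,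
      HahnSeries.coeff_sum, HahnSeries.coeff_zero] at h'
    rw [Finset.sum_filter, ← Finset.sum_congr rfl hterm]
    exact h'
  -- With this choice `-c' = a ^ (-p)`. On weight `N` one has `a ^ N * a ^ (-p i) = a ^ j`, so the
  -- sum required is `a ^ (-N)` times `hsum`.
  refine ⟨-(a ^ p)⁻¹, totalDegree_triangularHom_lt hp hf _ hwt ?_⟩
  have hfilter : (f - C c).support.filter (fun m => p * m 0 + m 1 = f.totalDegree) =
      f.support.filter (fun m => p * m 0 + m 1 = f.totalDegree) := by
    ext m
    rw [Finset.mem_filter, Finset.mem_filter]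
    refine and_congr_left fun h => mem_support_sub_C ?_ c
    rintro rfl
    simp at h
    omega
  rw [hfilter] at hsum
  have haN : a ^ f.totalDegree ≠ 0 := pow_ne_zero _ ha
  apply (mul_eq_zero.1 _).resolve_left haN
  rw [← hsum, Finset.mul_sum]
  refine Finset.sum_congr rfl fun m hm => ?_
  have h := (Finset.mem_filter.1 hm).2
  have h0 : m ≠ 0 := by
    rintro rfl
    simp at h
    omega
  rw [coeff_sub_C_of_ne h0, neg_neg, ← h, pow_add, pow_mul, inv_pow]
  field_simp

end MvPolynomial

/-! ### The root of a reduced diagram that is not minimal -/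

namespace SpliceDiagram

variable {D E : SpliceDiagram}

theorem isReduced_iff : D.IsReduced ↔
    (∀ u v, D.graph.Adj u v → D.IsLeaf v → D.HasWeights u → D.weight u v ≠ 1) ∧
      ∀ v, ¬ D.isArrow v → ¬ D.isRoot v → D.valency v ≠ 2 := by
  constructor
  · intro h
    exact ⟨fun u v huv hv hu hw => h _ (.deleteLeaf D u v huv hv hu hw),
      fun v hv hr h2 => h _ (.removeNode D v hv hr h2)⟩
  · rintro ⟨h1, h2⟩ E hE
    cases hE with
    | deleteLeaf u v huv hv hu hw => exact h1 u v huv hv hu hw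
    | removeNode v hv hr h => exact h2 v hv hr h

/-- The identity isomorphism. -/
def Iso.refl (D : SpliceDiagram) : Iso D D :=
  ⟨Equiv.refl _, fun _ _ => Iff.rfl, fun _ => Iff.rfl, fun _ => Iff.rfl, fun _ _ _ _ => rfl⟩

theorem Iso.valency_eq (e : Iso D E) (v : D.V) : E.valency (e.toEquiv v) = D.valency v := by
  have : E.graph.neighborSet (e.toEquiv v) = e.toEquiv '' D.graph.neighborSet v := by
    ext w
    obtain ⟨w, rfl⟩ := e.toEquiv.surjective w
    rw [SimpleGraph.mem_neighborSet, e.adj_iff]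
    simp
  rw [valency, valency, this, Set.ncard_image_of_injective _ e.toEquiv.injective]

theorem Iso.isLeaf_iff (e : Iso D E) (v : D.V) : E.IsLeaf (e.toEquiv v) ↔ D.IsLeaf v := by
  rw [IsLeaf, IsLeaf, e.arrow_iff, e.root_iff, e.valency_eq]

theorem Iso.hasWeights_iff (e : Iso D E) (v : D.V) :
    E.HasWeights (e.toEquiv v) ↔ D.HasWeights v := by
  rw [HasWeights, HasWeights, e.arrow_iff, e.root_iff, e.valency_eq]

theorem Iso.isReduced (e : Iso D E) (h : D.IsReduced) : E.IsReduced := by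
  rw [isReduced_iff] at h ⊢
  constructor
  · intro u v
    obtain ⟨u, rfl⟩ := e.toEquiv.surjective u
    obtain ⟨v, rfl⟩ := e.toEquiv.surjective v
    rw [e.adj_iff, e.isLeaf_iff, e.hasWeights_iff]
    intro huv hv hu
    rw [e.weight_eq u v huv hu]
    exact h.1 u v huv hv hu
  · intro v
    obtain ⟨v, rfl⟩ := e.toEquiv.surjective v
    rw [e.arrow_iff, e.root_iff, e.valency_eq]
    exact h.2 v

/-- The vertex `ρ` is the only root, its weights are `1`, and no two of its neighbours are
adjacent. -/
structure IsRootedAt (D : SpliceDiagram) (ρ : D.V) : Prop where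
  isRoot_iff : ∀ v, D.isRoot v ↔ v = ρ
  not_isArrow : ¬ D.isArrow ρ
  weight_eq : ∀ v, D.graph.Adj ρ v → D.weight ρ v = 1
  not_adj : ∀ a b, D.graph.Adj ρ a → D.graph.Adj ρ b → ¬ D.graph.Adj a b

theorem IsRootedAt.hasWeights {ρ : D.V} (h : D.IsRootedAt ρ) : D.HasWeights ρ :=
  ⟨h.not_isArrow, Or.inl ((h.isRoot_iff ρ).2 rfl)⟩

theorem Iso.isRootedAt (e : Iso D E) {ρ : D.V} (h : D.IsRootedAt ρ) :
    E.IsRootedAt (e.toEquiv ρ) where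
  isRoot_iff v := by
    obtain ⟨v, rfl⟩ := e.toEquiv.surjective v
    rw [e.root_iff, h.isRoot_iff, e.toEquiv.apply_eq_iff_eq]
  not_isArrow := by rw [e.arrow_iff]; exact h.not_isArrow
  weight_eq v := by
    obtain ⟨v, rfl⟩ := e.toEquiv.surjective v
    rw [e.adj_iff]
    intro hv
    rw [e.weight_eq _ _ hv h.hasWeights, h.weight_eq v hv]
  not_adj a b := by
    obtain ⟨a, rfl⟩ := e.toEquiv.surjective a
    obtain ⟨b, rfl⟩ := e.toEquiv.surjective b
    rw [e.adj_iff, e.adj_iff, e.adj_iff]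
    exact h.not_adj a b

open scoped Classical in
-- The root is put back where it was. Should it have become a leaf, the weight `1` assigned by
-- `rootAtVertex` agrees with the root weights of `D`.
theorem isMinimal_of_isReduced_unroot {ρ : D.V} (h : D.IsRootedAt ρ)
    (hred : D.unroot.IsReduced) : D.IsMinimal := by
  refine Or.inr ⟨D.unroot, ⟨D.unroot, .refl, hred, ⟨.refl _⟩⟩, Or.inl ⟨ρ, h.not_isArrow, ⟨?_⟩⟩⟩
  refine ⟨Equiv.refl _, fun _ _ => Iff.rfl, fun _ => Iff.rfl, fun v => h.isRoot_iff v, ?_⟩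
  intro u v huv _
  by_cases hu : u = ρ
  · have h1 : D.weight u v = 1 := by rw [hu]; exact h.weight_eq v (hu ▸ huv)
    exact h1.trans (ite_eq_left_iff.2 fun _ => h1).symm
  · exact (if_neg fun h' => hu h'.1).symm

/-- `C` arises from `D` by removing `v` and coalescing the edges at it, roots being disregarded;
`val` is the inclusion of the vertices. -/
structure IsCoalescing (D : SpliceDiagram) (v : D.V) (C : SpliceDiagram) (val : C.V → D.V) :
    Prop where
  injective : Function.Injective val
  val_ne : ∀ u, val u ≠ v
  exists_val_eq : ∀ x, x ≠ v → ∃ u, val u = x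
  adj_iff : ∀ u w, C.graph.Adj u w ↔ val u ≠ val w ∧
    (D.graph.Adj (val u) (val w) ∨ (D.graph.Adj (val u) v ∧ D.graph.Adj v (val w)))
  isArrow_iff : ∀ u, C.isArrow u ↔ D.isArrow (val u)
  weight_of_adj : ∀ u w, D.graph.Adj (val u) (val w) → C.weight u w = D.weight (val u) (val w)
  weight_of_not_adj : ∀ u w, ¬ D.graph.Adj (val u) (val w) → C.weight u w = D.weight (val u) v

theorem isCoalescing_coalesce (D : SpliceDiagram) (v : D.V) :
    IsCoalescing D v (D.coalesce v) Subtype.val where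
  injective := Subtype.val_injective
  val_ne u := u.2
  exists_val_eq x hx := ⟨⟨x, hx⟩, rfl⟩
  adj_iff u w := by
    refine (SimpleGraph.fromRel_adj _ u w).trans (and_congr
      (not_congr Subtype.val_injective.eq_iff.symm) ⟨?_, Or.inl⟩)
    rintro (h | h | h)
    · exact h
    · exact Or.inl h.symm
    · exact Or.inr ⟨h.2.symm, h.1.symm⟩
  isArrow_iff _ := Iff.rfl
  weight_of_adj _ _ h := if_pos h
  weight_of_not_adj _ _ h := if_neg h

theorem exists_isCoalescing_unroot {ρ : D.V} (h : ¬ D.isArrow ρ) (h2 : D.valency ρ = 2) :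
    ∃ (C : SpliceDiagram) (val : C.V → D.V), Step D.unroot C ∧ IsCoalescing D ρ C val ∧
      ∀ u, ¬ C.isRoot u := by
  have h1 := isCoalescing_coalesce D.unroot ρ
  exact ⟨D.unroot.coalesce ρ, Subtype.val, .removeNode D.unroot ρ h not_false h2,
    ⟨h1.1, h1.2, h1.3, h1.4, h1.5, h1.6, h1.7⟩, fun _ => not_false⟩

theorem nonempty_iso_rootOnEdge (C D : SpliceDiagram) (a b : C.V) (e : Option C.V ≃ D.V)
    (hadj : ∀ u w, D.graph.Adj (e (some u)) (e (some w)) ↔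
      C.graph.Adj u w ∧ ¬ (u = a ∧ w = b) ∧ ¬ (u = b ∧ w = a))
    (hadj0 : ∀ u, D.graph.Adj (e none) (e (some u)) ↔ u = a ∨ u = b)
    (harrow : ∀ u, D.isArrow (e (some u)) ↔ C.isArrow u) (harrow0 : ¬ D.isArrow (e none))
    (hroot : ∀ v, D.isRoot v ↔ v = e none)
    (hweight : ∀ u w, D.graph.Adj (e (some u)) (e (some w)) →
      D.weight (e (some u)) (e (some w)) = C.weight u w)
    (hweight0 : ∀ v, D.graph.Adj (e none) v → D.weight (e none) v = 1)
    (hweighta : D.weight (e (some a)) (e none) = C.weight a b)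
    (hweightb : D.weight (e (some b)) (e none) = C.weight b a) :
    Nonempty (Iso (C.rootOnEdge a b) D) := by
  have hadj_iff : ∀ u v : Option C.V, D.graph.Adj (e u) (e v) ↔
      (SimpleGraph.fromRel (C.subdivideRel a b)).Adj u v := by
    intro u v
    rw [SimpleGraph.fromRel_adj]
    rcases u with _ | u <;> rcases v with _ | v
    · simp
    · rw [hadj0]
      exact ⟨fun h => ⟨by simp, Or.inl h⟩, fun h => h.2.elim id id⟩
    · rw [D.graph.adj_comm, hadj0]
      exact ⟨fun h => ⟨by simp, Or.inl h⟩, fun h => h.2.elim id id⟩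
    · constructor
      · intro h
        refine ⟨?_, Or.inl ((hadj u v).1 h)⟩
        rintro h'
        rw [h'] at h
        exact D.graph.loopless.irrefl _ h
      · rintro ⟨-, h | h⟩
        · exact (hadj u v).2 h
        · exact ((hadj v u).2 h).symm
  refine ⟨⟨e, hadj_iff, ?_, ?_, ?_⟩⟩
  · rintro (_ | u)
    · refine iff_of_false harrow0 ?_
      rintro ⟨u, hu, -⟩
      cases hu
    · refine (harrow u).trans ⟨fun hu => ⟨u, rfl, hu⟩, ?_⟩
      rintro ⟨w, hw, hw'⟩
      cases hw
      exact hw'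
  · intro v
    exact (hroot (e v)).trans e.injective.eq_iff
  · intro u v huv _
    have huv' := (hadj_iff u v).2 huv
    rcases u with _ | u
    · exact hweight0 _ huv'
    · rcases v with _ | v
      · by_cases hu : u = a
        · refine Eq.trans ?_ (if_pos hu).symm
          rw [hu]; exact hweighta
        · refine Eq.trans ?_ (if_neg hu).symm
          rw [((hadj0 u).1 huv'.symm).resolve_left hu]; exact hweightb
      · exact hweight u v huv'

/-- Each of `a` and `b` exchanges the neighbour `ρ` for the other one, which is new because they
were not adjacent. The remaining neighbourhoods do not change. -/
theorem IsCoalescing.valency_eq {ρ a b : D.V} {C : SpliceDiagram} {val : C.V → D.V}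
    (hC : IsCoalescing D ρ C val) (hN : D.graph.neighborSet ρ = {a, b})
    (hab : a ≠ b) (hnab : ¬ D.graph.Adj a b) (u : C.V) :
    C.valency u = D.valency (val u) := by
  have hadj : ∀ x, D.graph.Adj ρ x ↔ x = a ∨ x = b := fun x => by
    rw [← SimpleGraph.mem_neighborSet, hN]; rfl
  rw [valency, ← Set.ncard_image_of_injective _ hC.injective, valency]
  have hmem : ∀ x : D.V, x ∈ val '' C.graph.neighborSet u ↔
      x ≠ ρ ∧ val u ≠ x ∧ (D.graph.Adj (val u) x ∨ (D.graph.Adj (val u) ρ ∧ D.graph.Adj ρ x)) := by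
    intro x
    constructor
    · rintro ⟨w, hw, rfl⟩
      rw [SimpleGraph.mem_neighborSet, hC.adj_iff] at hw
      exact ⟨hC.val_ne w, hw⟩
    · rintro ⟨hx, h⟩
      obtain ⟨w, rfl⟩ := hC.exists_val_eq x hx
      exact ⟨w, (hC.adj_iff u w).2 h, rfl⟩
  have main : ∀ y : D.V, D.graph.Adj (val u) ρ → y ≠ ρ → ¬ D.graph.Adj (val u) y → val u ≠ y →
      (∀ x, D.graph.Adj ρ x ↔ x = val u ∨ x = y) →
      (val '' C.graph.neighborSet u).ncard = (D.graph.neighborSet (val u)).ncard := by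
    intro y hu hy huy hne hρ
    rw [← Set.ncard_exchange (s := D.graph.neighborSet (val u)) (a := y) (b := ρ) huy hu]
    congr 1
    ext x
    rw [hmem, hρ]
    constructor
    · rintro ⟨h1, h2, h3 | ⟨-, h3 | h3⟩⟩
      · exact Or.inr ⟨h3, h1⟩
      · exact absurd h3.symm h2
      · exact Or.inl h3
    · rintro (rfl | ⟨h1, h2⟩)
      · exact ⟨hy, hne, Or.inr ⟨hu, Or.inr rfl⟩⟩
      · exact ⟨h2, (D.graph.ne_of_adj h1), Or.inl h1⟩
  have ha : D.graph.Adj ρ a := (hadj a).2 (Or.inl rfl)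
  have hb : D.graph.Adj ρ b := (hadj b).2 (Or.inr rfl)
  by_cases hu : D.graph.Adj (val u) ρ
  · rcases (hadj (val u)).1 hu.symm with h | h
    · refine main b hu hb.ne' ?_ ?_ ?_
      · rwa [h]
      · rwa [h]
      · rwa [h]
    · refine main a hu ha.ne' ?_ ?_ ?_
      · rw [h]; exact fun h' => hnab h'.symm
      · rw [h]; exact hab.symm
      · intro x; rw [hadj, h, or_comm]
  · congr 1
    ext x
    rw [hmem]
    constructor
    · rintro ⟨-, -, h | ⟨h, -⟩⟩
      · exact h
      · exact absurd h hu
    · intro h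
      refine ⟨?_, D.graph.ne_of_adj h, Or.inl h⟩
      rintro rfl
      exact hu h

/-- A reduction of `C` would give one of `D`: valencies agree, and a leaf at an end of the new edge
would have been a leaf at the root, where the weight is `1`. -/
theorem IsCoalescing.isReduced {ρ a b : D.V} {C : SpliceDiagram} {val : C.V → D.V}
    (hC : IsCoalescing D ρ C val) (hCr : ∀ u, ¬ C.isRoot u) (h : D.IsRootedAt ρ)
    (hD : D.IsReduced) (hN : D.graph.neighborSet ρ = {a, b}) (hab : a ≠ b)
    (hnab : ¬ D.graph.Adj a b) : C.IsReduced := by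
  rw [isReduced_iff] at hD ⊢
  have hval := hC.valency_eq hN hab hnab
  have hroot : ∀ u, ¬ D.isRoot (val u) := fun u hu => hC.val_ne u ((h.isRoot_iff _).1 hu)
  constructor
  · rintro u v huv ⟨hv1, -, hv2⟩ ⟨hu1, hu2⟩ hw
    rw [hval] at hv2 hu2
    rw [hC.isArrow_iff] at hv1 hu1
    have hv : D.IsLeaf (val v) := ⟨hv1, hroot v, hv2⟩
    rcases ((hC.adj_iff u v).1 huv).2 with h1 | ⟨-, h1⟩
    · rw [hC.weight_of_adj u v h1] at hw
      exact hD.1 _ _ h1 hv ⟨hu1, Or.inr (hu2.resolve_left (hCr u))⟩ hw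
    · exact hD.1 ρ _ h1 hv h.hasWeights (h.weight_eq _ h1)
  · intro v hv _
    rw [hval]
    rw [hC.isArrow_iff] at hv
    exact hD.2 _ hv (hroot v)

/-- The inclusion of the vertices, and the removed vertex, make up all vertices. -/
theorem IsCoalescing.exists_equiv {v : D.V} {C : SpliceDiagram} {val : C.V → D.V}
    (hC : IsCoalescing D v C val) :
    ∃ e : Option C.V ≃ D.V, e none = v ∧ ∀ u, e (some u) = val u := by
  refine ⟨Equiv.ofBijective (fun o => o.elim v val) ⟨?_, ?_⟩, rfl, fun _ => rfl⟩
  · rintro (_ | a) (_ | b) hab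
    · rfl
    · exact absurd hab.symm (hC.val_ne b)
    · exact absurd hab (hC.val_ne a)
    · exact congrArg some (hC.injective hab)
  · intro x
    by_cases hx : x = v
    · exact ⟨none, hx.symm⟩
    · obtain ⟨u, rfl⟩ := hC.exists_val_eq x hx
      exact ⟨some u, rfl⟩

/-- The root of valency two subdivides the edge that its removal creates, and is put back on that
edge. -/
theorem isMinimal_of_neighborSet_eq_pair {ρ a b : D.V} (h : D.IsRootedAt ρ) (hD : D.IsReduced)
    (hN : D.graph.neighborSet ρ = {a, b}) (hab : a ≠ b) : D.IsMinimal := by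
  have hadj : ∀ x, D.graph.Adj ρ x ↔ x = a ∨ x = b := fun x => by
    rw [← SimpleGraph.mem_neighborSet, hN]; rfl
  have ha : D.graph.Adj ρ a := (hadj a).2 (Or.inl rfl)
  have hb : D.graph.Adj ρ b := (hadj b).2 (Or.inr rfl)
  have hnab := h.not_adj a b ha hb
  obtain ⟨C, val, hstep, hC, hCr⟩ := exists_isCoalescing_unroot h.not_isArrow
    (show D.valency ρ = 2 by rw [valency, hN, Set.ncard_pair hab])
  obtain ⟨e, he0, he⟩ := hC.exists_equiv
  obtain ⟨a, rfl⟩ := hC.exists_val_eq a ha.ne'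
  obtain ⟨b, rfl⟩ := hC.exists_val_eq b hb.ne'
  refine Or.inr ⟨C, ⟨C, .single hstep, hC.isReduced hCr h hD hN hab hnab, ⟨.refl _⟩⟩,
    Or.inr ⟨a, b, (hC.adj_iff a b).2 ⟨hab, Or.inr ⟨ha.symm, hb⟩⟩, ?_⟩⟩
  apply nonempty_iso_rootOnEdge C D a b e
  · intro u w
    rw [he, he, hC.adj_iff]
    constructor
    · intro h1
      refine ⟨⟨D.graph.ne_of_adj h1, Or.inl h1⟩, ?_, ?_⟩
      · rintro ⟨rfl, rfl⟩
        exact hnab h1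
      · rintro ⟨rfl, rfl⟩
        exact hnab h1.symm
    · rintro ⟨⟨hne, h1 | ⟨h1, h2⟩⟩, h3, h4⟩
      · exact h1
      · exfalso
        rcases (hadj _).1 h1.symm with h5 | h5 <;> rcases (hadj _).1 h2 with h6 | h6
        · exact hne (h5.trans h6.symm)
        · exact h3 ⟨hC.injective h5, hC.injective h6⟩
        · exact h4 ⟨hC.injective h5, hC.injective h6⟩
        · exact hne (h5.trans h6.symm)
  · intro u
    rw [he0, he, hadj, hC.injective.eq_iff, hC.injective.eq_iff]
  · intro u
    rw [he, hC.isArrow_iff]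
  · rw [he0]; exact h.not_isArrow
  · rw [he0]; exact h.isRoot_iff
  · intro u w huw
    rw [he, he] at *
    exact (hC.weight_of_adj u w huw).symm
  · rw [he0]; exact h.weight_eq
  · rw [he, he0, hC.weight_of_not_adj a b hnab]
  · rw [he, he0, hC.weight_of_not_adj b a fun h' => hnab h'.symm]

/-- In a reduced diagram that is not minimal the root is joined to a single vertex, by an edge
with weights `1`. -/
theorem exists_neighbor_of_not_isMinimal {ρ : D.V} (h : D.IsRootedAt ρ) (hD : D.IsReduced)
    (hmin : ¬ D.IsMinimal) :
    ∃ v, D.graph.neighborSet ρ = {v} ∧ D.HasWeights v ∧ D.weight v ρ = 1 := by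
  by_contra hcon
  push Not at hcon
  have h2 : D.valency ρ ≠ 2 := by
    intro h2
    obtain ⟨a, b, hab, hN⟩ := Set.ncard_eq_two.1 h2
    exact hmin (isMinimal_of_neighborSet_eq_pair h hD hN hab)
  apply hmin
  -- A reduction that unrooting makes possible must delete the former root as a leaf, which `hcon`
  -- excludes, or remove it as a node of valency two, which `h2` excludes.
  apply isMinimal_of_isReduced_unroot h
  rw [isReduced_iff] at hD ⊢
  constructor
  · rintro u v huv ⟨hv1, -, hv2⟩ ⟨hu1, hu2⟩ hw
    have hu3 : D.HasWeights u := ⟨hu1, Or.inr (hu2.resolve_left not_false)⟩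
    by_cases hv : v = ρ
    · subst hv
      obtain ⟨x, hx⟩ := Set.ncard_eq_one.1 hv2
      have hux : u = x := by
        have : u ∈ D.unroot.graph.neighborSet v := huv.symm
        rwa [hx] at this
      subst hux
      exact hcon u hx hu3 hw
    · exact hD.1 u v huv ⟨hv1, fun h' => hv ((h.isRoot_iff v).1 h'), hv2⟩ hu3 hw
  · intro v hv _
    by_cases hvρ : v = ρ
    · subst hvρ; exact h2
    · exact hD.2 v hv fun h' => hvρ ((h.isRoot_iff v).1 h')

end SpliceDiagram

/-! ### Tree orders and splice trees -/

/-- The strict order of a rooted tree with finite branches to the root: `lt u v` says that `u`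
lies on the path from the root to `v`. -/
structure IsTreeOrder {T : Type*} (lt : T → T → Prop) (ρ : T) : Prop where
  irrefl : ∀ u, ¬ lt u u
  trans : ∀ {u v w}, lt u v → lt v w → lt u w
  root_lt : ∀ {u}, u ≠ ρ → lt ρ u
  chain : ∀ {u v w}, lt u w → lt v w → u = v ∨ lt u v ∨ lt v u
  finite : ∀ w, {u | lt u w}.Finite

/-- `v` follows `u` immediately. -/
def RelCovers {T : Type*} (lt : T → T → Prop) (u v : T) : Prop :=
  lt u v ∧ ∀ w, ¬ (lt u w ∧ lt w v)

namespace IsTreeOrder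

variable {T : Type*} {lt : T → T → Prop} {ρ : T}

theorem asymm (h : IsTreeOrder lt ρ) {u v : T} (huv : lt u v) : ¬ lt v u :=
  fun hvu => h.irrefl u (h.trans huv hvu)

theorem not_lt_root (h : IsTreeOrder lt ρ) (u : T) : ¬ lt u ρ := by
  intro hu
  by_cases h' : u = ρ
  · subst h'; exact h.irrefl _ hu
  · exact h.asymm hu (h.root_lt h')

theorem comap {S : Type*} (h : IsTreeOrder lt ρ) {φ : S → T} (hφ : Function.Injective φ) {σ : S}
    (hσ : φ σ = ρ) : IsTreeOrder (fun u v => lt (φ u) (φ v)) σ where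
  irrefl u := h.irrefl _
  trans h1 h2 := h.trans h1 h2
  root_lt {u} hu := by
    rw [hσ]
    exact h.root_lt fun h' => hu (hφ (h'.trans hσ.symm))
  chain h1 h2 := (h.chain h1 h2).imp (fun h' => hφ h') id
  finite w := (h.finite (φ w)).preimage hφ.injOn

/-- The number of predecessors serves as depth when immediate predecessors and successors are
selected. -/
theorem ncard_lt_ncard (h : IsTreeOrder lt ρ) {u v : T} (huv : lt u v) :
    {z | lt z u}.ncard < {z | lt z v}.ncard :=
  Set.ncard_lt_ncard ⟨fun _ hz => h.trans hz huv, fun h' => h.irrefl u (h' huv)⟩ (h.finite v)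

theorem exists_covers (h : IsTreeOrder lt ρ) {v : T} (hv : v ≠ ρ) : ∃ u, RelCovers lt u v := by
  obtain ⟨u, hu, hmax⟩ := Set.exists_max_image {u | lt u v} (fun u => {z | lt z u}.ncard)
    (h.finite v) ⟨ρ, h.root_lt hv⟩
  exact ⟨u, hu, fun w hw => (h.ncard_lt_ncard hw.1).not_ge (hmax w hw.2)⟩

theorem covers_unique (h : IsTreeOrder lt ρ) {u u' v : T} (hu : RelCovers lt u v)
    (hu' : RelCovers lt u' v) : u = u' := by
  rcases h.chain hu.1 hu'.1 with h1 | h1 | h1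
  · exact h1
  · exact absurd ⟨h1, hu'.1⟩ (hu.2 u')
  · exact absurd ⟨h1, hu.1⟩ (hu'.2 u)

theorem exists_covers_of_lt (h : IsTreeOrder lt ρ) {u w : T} (huw : lt u w) :
    ∃ v, RelCovers lt u v ∧ (v = w ∨ lt v w) := by
  have hfin : {v | lt u v ∧ (v = w ∨ lt v w)}.Finite :=
    ((h.finite w).insert w).subset fun v hv => hv.2
  obtain ⟨v, hv, hmin⟩ := Set.exists_min_image _ (fun u => {z | lt z u}.ncard) hfin
    ⟨w, huw, Or.inl rfl⟩
  refine ⟨v, ⟨hv.1, fun z hz => (h.ncard_lt_ncard hz.2).not_ge (hmin z ⟨hz.1, Or.inr ?_⟩)⟩, hv.2⟩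
  rcases hv.2 with h1 | h1
  · exact h1 ▸ hz.2
  · exact h.trans hz.2 h1

/-- Covering after the removal of a vertex. -/
theorem covers_subtype_iff (h : IsTreeOrder lt ρ) {S : Type*} {val : S → T} {v : T}
    (hval : ∀ u, val u ≠ v) (hsurj : ∀ x, x ≠ v → ∃ u, val u = x) (u w : S) :
    RelCovers (fun x y => lt (val x) (val y)) u w ↔
      RelCovers lt (val u) (val w) ∨ (RelCovers lt (val u) v ∧ RelCovers lt v (val w)) := by
  constructor
  · rintro ⟨h1, h2⟩
    have key : ∀ z, z ≠ v → ¬ (lt (val u) z ∧ lt z (val w)) := by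
      intro z hz
      obtain ⟨z, rfl⟩ := hsurj z hz
      exact h2 z
    by_cases hv : lt (val u) v ∧ lt v (val w)
    · refine Or.inr ⟨⟨hv.1, fun z hz => ?_⟩, ⟨hv.2, fun z hz => ?_⟩⟩
      · refine key z ?_ ⟨hz.1, h.trans hz.2 hv.2⟩
        rintro rfl; exact h.irrefl _ hz.2
      · refine key z ?_ ⟨h.trans hv.1 hz.1, hz.2⟩
        rintro rfl; exact h.irrefl _ hz.1
    · refine Or.inl ⟨h1, fun z hz => ?_⟩
      by_cases hzv : z = v
      · exact hv (hzv ▸ hz)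
      · exact key z hzv hz
  · rintro (h1 | ⟨h1, h2⟩)
    · exact ⟨h1.1, fun z => h1.2 (val z)⟩
    · refine ⟨h.trans h1.1 h2.1, fun z hz => ?_⟩
      rcases h.chain hz.2 h2.1 with h3 | h3 | h3
      · exact hval z h3
      · exact h1.2 _ ⟨hz.1, h3⟩
      · exact h2.2 _ ⟨h3, hz.2⟩

end IsTreeOrder

/-- The combinatorial data of an unreduced rooted splice diagram: a tree order on the vertices,
the arrowheads, weights that at a vertex depend only on the direction, and the extra leaves:
`tip n l` says that `l` is a leaf attached to the node `n`. -/
structure IsSpliceTree {T : Type*} (lt : T → T → Prop) (ρ : T) (arrow : T → Prop)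
    (W : T → T → ℤ) (tip : T → T → Prop) : Prop where
  order : IsTreeOrder lt ρ
  not_arrow_root : ¬ arrow ρ
  weight_root : ∀ v, W ρ v = 1
  weight_down : ∀ {u v w}, lt u v → lt v w → W u v = W u w
  weight_up : ∀ {u v w}, lt w v → lt v u → W u v = W u w
  tip_covers : ∀ {n l}, tip n l → RelCovers lt n l
  tip_maximal : ∀ {n l}, tip n l → ∀ z, ¬ lt l z
  tip_not_arrow : ∀ {n l}, tip n l → ¬ arrow l
  tip_ne_root : ∀ {n l}, tip n l → n ≠ ρ
  exists_arrow : ∀ {n l}, tip n l → ∃ a, arrow a ∧ lt n a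

/-- The diagram `E` consists of some of the vertices of a splice tree, among them the root, the
arrowheads, and the extra leaves, with the nodes they are attached to, whose edge does not have
weight `1`. -/
structure SpliceDiagram.IsPruning {T : Type*} (lt : T → T → Prop) (ρ : T) (arrow : T → Prop)
    (W : T → T → ℤ) (tip : T → T → Prop) (E : SpliceDiagram) (φ : E.V → T) : Prop where
  injective : Function.Injective φ
  exists_root : ∃ σ, φ σ = ρ
  exists_arrow : ∀ a, arrow a → ∃ v, φ v = a
  exists_tip : ∀ n l, tip n l → W n l ≠ 1 → (∃ v, φ v = n) ∧ ∃ v, φ v = l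
  adj_iff : ∀ u v, E.graph.Adj u v ↔
    RelCovers (fun x y => lt (φ x) (φ y)) u v ∨ RelCovers (fun x y => lt (φ x) (φ y)) v u
  isArrow_iff : ∀ v, E.isArrow v ↔ arrow (φ v)
  isRoot_iff : ∀ v, E.isRoot v ↔ φ v = ρ
  weight_eq : ∀ u v, E.graph.Adj u v → E.weight u v = W (φ u) (φ v)

/-! ### Reductions as prunings of a splice tree -/

namespace SpliceDiagram

variable {T : Type*} {lt : T → T → Prop} {ρ : T} {arrow : T → Prop} {W : T → T → ℤ}
  {tip : T → T → Prop} {E E' : SpliceDiagram} {φ : E.V → T}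

theorem IsPruning.exists_isTreeOrder (hE : IsPruning lt ρ arrow W tip E φ)
    (hT : IsSpliceTree lt ρ arrow W tip) :
    ∃ σ, φ σ = ρ ∧ IsTreeOrder (fun x y => lt (φ x) (φ y)) σ := by
  obtain ⟨σ, hσ⟩ := hE.exists_root
  exact ⟨σ, hσ, hT.order.comap hE.injective hσ⟩

/-- A vertex of valency one other than the root is maximal. -/
theorem IsPruning.not_lt_of_valency_eq_one (hE : IsPruning lt ρ arrow W tip E φ)
    (hT : IsSpliceTree lt ρ arrow W tip) {v : E.V} (hv : ¬ E.isRoot v) (h1 : E.valency v = 1)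
    (w : E.V) : ¬ lt (φ v) (φ w) := by
  obtain ⟨σ, hσ, ho⟩ := hE.exists_isTreeOrder hT
  intro hvw
  obtain ⟨u, hu⟩ := ho.exists_covers (v := v) (by
    rintro rfl; exact hv ((hE.isRoot_iff _).2 hσ))
  obtain ⟨x, hx, -⟩ := ho.exists_covers_of_lt hvw
  obtain ⟨y, hy⟩ := Set.ncard_eq_one.1 h1
  have hu' : u ∈ E.graph.neighborSet v := (hE.adj_iff v u).2 (Or.inr hu)
  have hx' : x ∈ E.graph.neighborSet v := (hE.adj_iff v x).2 (Or.inl hx)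
  rw [hy, Set.mem_singleton_iff] at hu' hx'
  subst hu' hx'
  exact ho.asymm hu.1 hx.1

/-- A vertex of valency two other than the root has just one immediate successor. -/
theorem IsPruning.exists_covers_of_valency_eq_two (hE : IsPruning lt ρ arrow W tip E φ)
    (hT : IsSpliceTree lt ρ arrow W tip) {v : E.V} (hv : ¬ E.isRoot v) (h2 : E.valency v = 2) :
    ∃ x, RelCovers (fun x y => lt (φ x) (φ y)) v x ∧
      ∀ y, RelCovers (fun x y => lt (φ x) (φ y)) v y → y = x := by
  obtain ⟨σ, hσ, ho⟩ := hE.exists_isTreeOrder hT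
  obtain ⟨u, hu⟩ := ho.exists_covers (v := v) (by
    rintro rfl; exact hv ((hE.isRoot_iff _).2 hσ))
  obtain ⟨a, b, hab, hN⟩ := Set.ncard_eq_two.1 h2
  have hadj : ∀ x, E.graph.Adj v x ↔ x = a ∨ x = b := fun x => by
    rw [← SimpleGraph.mem_neighborSet, hN]; rfl
  have main : ∀ x, x ≠ u → E.graph.Adj v x → (∀ y, E.graph.Adj v y → y = u ∨ y = x) →
      ∃ x, RelCovers (fun x y => lt (φ x) (φ y)) v x ∧
      ∀ y, RelCovers (fun x y => lt (φ x) (φ y)) v y → y = x := by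
    intro x hxu hx hall
    refine ⟨x, ?_, fun y hy => ?_⟩
    · rcases (hE.adj_iff v x).1 hx with h | h
      · exact h
      · exact absurd (ho.covers_unique h hu) hxu
    · refine (hall y ((hE.adj_iff v y).2 (Or.inl hy))).resolve_left ?_
      rintro rfl
      exact ho.asymm hu.1 hy.1
  rcases (hadj u).1 ((hE.adj_iff v u).2 (Or.inr hu)) with rfl | rfl
  · exact main b hab.symm ((hadj b).2 (Or.inr rfl)) fun y hy => (hadj y).1 hy
  · exact main a hab ((hadj a).2 (Or.inl rfl)) fun y hy => ((hadj y).1 hy).symm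

/-- The deleted leaf is maximal, so no other covering relation changes. An extra leaf of weight
other than `1` is safe because its only neighbour is its node, and that node is not maximal. -/
theorem IsPruning.delete (hE : IsPruning lt ρ arrow W tip E φ)
    (hT : IsSpliceTree lt ρ arrow W tip) {u v : E.V} (huv : E.graph.Adj u v) (hv : E.IsLeaf v)
    (hw : E.weight u v = 1) :
    IsPruning lt ρ arrow W tip (E.delete v) (fun x => φ x.1) := by
  obtain ⟨σ, hσ, ho⟩ := hE.exists_isTreeOrder hT
  have hmax := hE.not_lt_of_valency_eq_one hT hv.2.1 hv.2.2
  have hadj : ∀ x y : (E.delete v).V, (E.delete v).graph.Adj x y ↔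
      RelCovers (fun x y : (E.delete v).V => lt (φ x.1) (φ y.1)) x y ∨
      RelCovers (fun x y : (E.delete v).V => lt (φ x.1) (φ y.1)) y x := by
    intro x y
    have key : ∀ x y : (E.delete v).V,
        RelCovers (fun x y : (E.delete v).V => lt (φ x.1) (φ y.1)) x y ↔
        RelCovers (fun x y => lt (φ x) (φ y)) x.1 y.1 := fun x y =>
      (ho.covers_subtype_iff (val := fun x : (E.delete v).V => x.1) (fun u => u.2)
        (fun x hx => ⟨⟨x, hx⟩, rfl⟩) x y).trans
        (or_iff_left fun h => hmax _ h.2.1)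
    exact (hE.adj_iff x.1 y.1).trans (or_congr (key x y).symm (key y x).symm)
  refine ⟨hE.injective.comp Subtype.val_injective, ?_, ?_, ?_, hadj, fun x => hE.isArrow_iff x.1,
    fun x => hE.isRoot_iff x.1, fun x y hxy => hE.weight_eq x.1 y.1 hxy⟩
  · refine ⟨⟨σ, ?_⟩, hσ⟩
    rintro rfl
    exact hv.2.1 ((hE.isRoot_iff _).2 hσ)
  · intro a ha
    obtain ⟨x, rfl⟩ := hE.exists_arrow a ha
    refine ⟨⟨x, ?_⟩, rfl⟩
    rintro rfl
    exact hv.1 ((hE.isArrow_iff _).2 ha)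
  · intro n l hnl hW
    obtain ⟨⟨n, rfl⟩, ⟨l, rfl⟩⟩ := hE.exists_tip n l hnl hW
    have hcov := hT.tip_covers hnl
    refine ⟨⟨⟨n, ?_⟩, rfl⟩, ⟨⟨l, ?_⟩, rfl⟩⟩
    · rintro rfl
      exact hmax l hcov.1
    · rintro rfl
      have hul : u = n := by
        rcases (hE.adj_iff u l).1 huv with h | h
        · exact ho.covers_unique h ⟨hcov.1, fun w => hcov.2 (φ w)⟩
        · exact absurd h.1 (hmax u)
      subst hul
      exact hW (by rw [← hE.weight_eq _ _ huv, hw])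

/-- The removed node has one predecessor and one successor, so the new edge is the new covering
relation. Its weights are right because they depend only on the direction. -/
theorem IsPruning.of_isCoalescing (hE : IsPruning lt ρ arrow W tip E φ)
    (hT : IsSpliceTree lt ρ arrow W tip) {v : E.V} (hv : ¬ E.isArrow v) (hr : ¬ E.isRoot v)
    (h2 : E.valency v = 2) {C : SpliceDiagram} {val : C.V → E.V} (hC : IsCoalescing E v C val)
    (hCr : ∀ u, C.isRoot u ↔ E.isRoot (val u)) :
    IsPruning lt ρ arrow W tip C (fun x => φ (val x)) := by
  obtain ⟨σ, hσ, ho⟩ := hE.exists_isTreeOrder hT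
  obtain ⟨c, hc, hcu⟩ := hE.exists_covers_of_valency_eq_two hT hr h2
  have hcov := ho.covers_subtype_iff hC.val_ne hC.exists_val_eq
  have hadj : ∀ x y, C.graph.Adj x y ↔
      RelCovers (fun x y => lt (φ (val x)) (φ (val y))) x y ∨
      RelCovers (fun x y => lt (φ (val x)) (φ (val y))) y x := by
    intro x y
    have e1 := hcov x y
    have e2 := hcov y x
    refine Iff.trans ?_ (or_congr e1 e2).symm
    rw [hC.adj_iff, hE.adj_iff, hE.adj_iff, hE.adj_iff]
    constructor
    · rintro ⟨hne, (h | h) | ⟨h1 | h1, h2 | h2⟩⟩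
      · exact Or.inl (Or.inl h)
      · exact Or.inr (Or.inl h)
      · exact Or.inl (Or.inr ⟨h1, h2⟩)
      · exact absurd (ho.covers_unique h1 h2) hne
      · exact absurd ((hcu _ h1).trans (hcu _ h2).symm) hne
      · exact Or.inr (Or.inr ⟨h2, h1⟩)
    · intro h
      refine ⟨fun he => ?_, ?_⟩
      · rcases h with (h | h) | h | h
        · exact ho.irrefl _ (by simpa only [he] using h.1)
        · exact ho.asymm h.1.1 (by simpa only [he] using h.2.1)
        · exact ho.irrefl _ (by simpa only [he] using h.1)
        · exact ho.asymm h.1.1 (by simpa only [he] using h.2.1)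
      · rcases h with (h | h) | h | h
        · exact Or.inl (Or.inl h)
        · exact Or.inr ⟨Or.inl h.1, Or.inl h.2⟩
        · exact Or.inl (Or.inr h)
        · exact Or.inr ⟨Or.inr h.2, Or.inr h.1⟩
  refine ⟨hE.injective.comp hC.injective, ?_, ?_, ?_, hadj,
    fun x => (hC.isArrow_iff x).trans (hE.isArrow_iff _),
    fun x => (hCr x).trans (hE.isRoot_iff _), ?_⟩
  · obtain ⟨τ, rfl⟩ := hC.exists_val_eq σ (by
      rintro rfl; exact hr ((hE.isRoot_iff _).2 hσ))
    exact ⟨τ, hσ⟩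
  · intro a ha
    obtain ⟨x, rfl⟩ := hE.exists_arrow a ha
    obtain ⟨x, rfl⟩ := hC.exists_val_eq x (by
      rintro rfl; exact hv ((hE.isArrow_iff _).2 ha))
    exact ⟨x, rfl⟩
  · intro n l hnl hW
    obtain ⟨⟨n, rfl⟩, ⟨l, rfl⟩⟩ := hE.exists_tip n l hnl hW
    have hcov := hT.tip_covers hnl
    have hcov' : RelCovers (fun x y => lt (φ x) (φ y)) n l := ⟨hcov.1, fun w => hcov.2 (φ w)⟩
    -- The node of a surviving extra leaf cannot be the removed one: an arrowhead lies beyond it in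
    -- another direction, so it has a second successor.
    obtain ⟨n', rfl⟩ := hC.exists_val_eq n (by
      rintro rfl
      obtain ⟨a, ha, hna⟩ := hT.exists_arrow hnl
      obtain ⟨a, rfl⟩ := hE.exists_arrow a ha
      obtain ⟨x, hx, hxa⟩ := ho.exists_covers_of_lt hna
      have hxl : x = l := (hcu x hx).trans (hcu l hcov').symm
      subst hxl
      rcases hxa with rfl | hxa
      · exact hT.tip_not_arrow hnl ha
      · exact hT.tip_maximal hnl _ hxa)
    obtain ⟨l', rfl⟩ := hC.exists_val_eq l (by
      rintro rfl
      exact hT.tip_maximal hnl _ hc.1)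
    exact ⟨⟨n', rfl⟩, ⟨l', rfl⟩⟩
  · intro x y hxy
    by_cases h : E.graph.Adj (val x) (val y)
    · rw [hC.weight_of_adj x y h, hE.weight_eq _ _ h]
    · rw [hC.weight_of_not_adj x y h]
      have h1 := ((hC.adj_iff x y).1 hxy).2.resolve_left h
      rw [hE.weight_eq _ _ h1.1]
      have hn : ¬ RelCovers (fun x y => lt (φ x) (φ y)) (val x) (val y) :=
        fun h' => h ((hE.adj_iff _ _).2 (Or.inl h'))
      have hn' : ¬ RelCovers (fun x y => lt (φ x) (φ y)) (val y) (val x) :=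
        fun h' => h ((hE.adj_iff _ _).2 (Or.inr h'))
      rcases (hadj x y).1 hxy with h3 | h3
      · have h4 := ((hcov x y).1 h3).resolve_left hn
        exact hT.weight_down h4.1.1 h4.2.1
      · have h4 := ((hcov y x).1 h3).resolve_left hn'
        exact hT.weight_up h4.1.1 h4.2.1

theorem IsPruning.step (hE : IsPruning lt ρ arrow W tip E φ)
    (hT : IsSpliceTree lt ρ arrow W tip) (h : Step E E') :
    ∃ φ' : E'.V → T, IsPruning lt ρ arrow W tip E' φ' := by
  cases h with
  | deleteLeaf u v huv hv hu hw => exact ⟨_, hE.delete hT huv hv hw⟩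
  | removeNode v hv hr h2 =>
    exact ⟨_, hE.of_isCoalescing hT hv hr h2 (isCoalescing_coalesce E v) fun _ => Iff.rfl⟩

theorem IsPruning.reflTransGen (hE : IsPruning lt ρ arrow W tip E φ)
    (hT : IsSpliceTree lt ρ arrow W tip) (h : Relation.ReflTransGen Step E E') :
    ∃ φ' : E'.V → T, IsPruning lt ρ arrow W tip E' φ' := by
  induction h with
  | refl => exact ⟨φ, hE⟩
  | tail _ h ih =>
    obtain ⟨ψ, hψ⟩ := ih
    exact hψ.step hT h

theorem IsPruning.isRootedAt (hE : IsPruning lt ρ arrow W tip E φ)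
    (hT : IsSpliceTree lt ρ arrow W tip) {σ : E.V} (hσ : φ σ = ρ) : E.IsRootedAt σ := by
  have ho := hT.order.comap hE.injective hσ
  refine ⟨fun v => ?_, ?_, ?_, ?_⟩
  · rw [hE.isRoot_iff, ← hσ, hE.injective.eq_iff]
  · rw [hE.isArrow_iff, hσ]
    exact hT.not_arrow_root
  · intro v hv
    rw [hE.weight_eq _ _ hv, hσ, hT.weight_root]
  · intro a b ha hb hab
    have h1 : ∀ x, E.graph.Adj σ x → RelCovers (fun x y => lt (φ x) (φ y)) σ x := fun x hx =>
      ((hE.adj_iff σ x).1 hx).resolve_right fun h => ho.not_lt_root _ h.1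
    rcases (hE.adj_iff a b).1 hab with h | h
    · exact (h1 b hb).2 a ⟨(h1 a ha).1, h.1⟩
    · exact (h1 a ha).2 b ⟨(h1 b hb).1, h.1⟩

/-- If a splice tree reduces to a diagram that is not minimal, then a single vertex `n` of the
tree lies above all arrowheads and has weight `1` towards the root, and the extra leaves at the
vertices between the root and `n` have weight `1`. -/
theorem IsPruning.exists_of_not_isMinimal {D : SpliceDiagram}
    (hE : IsPruning lt ρ arrow W tip E φ)
    (hT : IsSpliceTree lt ρ arrow W tip) (hD : E.ReducesTo D) (hmin : ¬ D.IsMinimal) :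
    ∃ n, n ≠ ρ ∧ ¬ arrow n ∧ (∃ z, lt n z) ∧ (∀ a, arrow a → lt n a) ∧ W n ρ = 1 ∧
      ∀ m l, tip m l → lt m n → W m l = 1 := by
  obtain ⟨F, hEF, hF, ⟨e⟩⟩ := hD
  obtain ⟨ψ, hψ⟩ := hE.reflTransGen hT hEF
  obtain ⟨σ, hσ, ho⟩ := hψ.exists_isTreeOrder hT
  have hroot := hψ.isRootedAt hT hσ
  obtain ⟨v, hv1, hv2, hv3⟩ := exists_neighbor_of_not_isMinimal (e.isRootedAt hroot)
    (e.isReduced hF) hmin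
  obtain ⟨v, rfl⟩ := e.toEquiv.surjective v
  have hadj : ∀ x, F.graph.Adj σ x ↔ x = v := fun x => by
    rw [← e.adj_iff, ← SimpleGraph.mem_neighborSet, hv1, Set.mem_singleton_iff,
      e.toEquiv.apply_eq_iff_eq]
  have hσv : F.graph.Adj σ v := (hadj v).2 rfl
  have hcov : RelCovers (fun x y => lt (ψ x) (ψ y)) σ v :=
    ((hψ.adj_iff σ v).1 hσv).resolve_right fun h => ho.not_lt_root _ h.1
  rw [e.hasWeights_iff] at hv2
  rw [e.weight_eq _ _ hσv.symm hv2, hψ.weight_eq _ _ hσv.symm, hσ] at hv3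
  have hvσ : v ≠ σ := hσv.ne'
  have hle : ∀ x, x ≠ σ → v = x ∨ lt (ψ v) (ψ x) := by
    intro x hx
    obtain ⟨y, hy, hyx⟩ := ho.exists_covers_of_lt (ho.root_lt hx)
    rw [(hadj y).1 ((hψ.adj_iff _ _).2 (Or.inl hy))] at hyx
    exact hyx
  have harrow : ¬ arrow (ψ v) := fun h => hv2.1 ((hψ.isArrow_iff v).2 h)
  refine ⟨ψ v, ?_, harrow, ?_, ?_, hv3, ?_⟩
  · rw [← hσ]
    exact fun h => hvσ (hψ.injective h)
  -- The only neighbour of `v` before it is the root, so valency at least two requires a vertex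
  -- beyond `v`.
  · have h2 : 2 ≤ F.valency v :=
      hv2.2.resolve_left fun h => hvσ ((hroot.isRoot_iff v).1 h)
    by_contra! hmax
    have : F.graph.neighborSet v ⊆ {σ} := by
      intro x hx
      rcases (hψ.adj_iff v x).1 hx with h | h
      · exact absurd h.1 (hmax _)
      · exact ho.covers_unique h hcov
    have := Set.ncard_le_ncard this
    rw [Set.ncard_singleton] at this
    rw [valency] at h2
    omega
  · intro a ha
    obtain ⟨x, rfl⟩ := hψ.exists_arrow a ha
    refine (hle x ?_).resolve_left ?_
    · rintro rfl
      exact hT.not_arrow_root (hσ ▸ ha)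
    · rintro rfl
      exact harrow ha
  -- An extra leaf of weight other than `1` would have kept its node, strictly between the root and
  -- its neighbour `v`.
  · intro m l hml hmn
    by_contra hW
    obtain ⟨⟨m, rfl⟩, -⟩ := hψ.exists_tip m l hml hW
    refine hcov.2 m ⟨ho.root_lt ?_, hmn⟩
    rintro rfl
    exact hT.tip_ne_root hml hσ

end SpliceDiagram

/-! ### Conjugate initial segments and finiteness of relevant exponents -/

namespace InfSeries

theorem ConjOn.refl (I : Set ℚ) (s : InfSeries) : ConjOn I s s := ⟨0, fun r _ => by simp⟩

theorem ConjOn.symm {I : Set ℚ} {s s' : InfSeries} (h : ConjOn I s s') : ConjOn I s' s := by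
  obtain ⟨k, hk⟩ := h
  refine ⟨-k, fun r hr => ?_⟩
  rw [hk r hr, ← mul_assoc, ← Complex.exp_add]
  have : 2 * Real.pi * Complex.I * ((-k : ℤ) : ℂ) * r + 2 * Real.pi * Complex.I * k * r = 0 := by
    push_cast; ring
  rw [this, Complex.exp_zero, one_mul]

theorem ConjOn.trans {I : Set ℚ} {s s' s'' : InfSeries} (h : ConjOn I s s')
    (h' : ConjOn I s' s'') : ConjOn I s s'' := by
  obtain ⟨k, hk⟩ := h
  obtain ⟨l, hl⟩ := h'
  refine ⟨l + k, fun r hr => ?_⟩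
  rw [hl r hr, hk r hr, ← mul_assoc, ← Complex.exp_add]
  congr 2
  push_cast; ring

theorem ConjOn.mono {I J : Set ℚ} {s s' : InfSeries} (hIJ : I ⊆ J) (h : ConjOn J s s') :
    ConjOn I s s' := by
  obtain ⟨k, hk⟩ := h
  exact ⟨k, fun r hr => hk r (hIJ hr)⟩

theorem ConjOn.xcoeff_eq_zero_iff {I : Set ℚ} {s s' : InfSeries} (h : ConjOn I s s') {r : ℚ}
    (hr : r ∈ I) : s'.xcoeff r = 0 ↔ s.xcoeff r = 0 := by
  obtain ⟨k, hk⟩ := h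
  rw [hk r hr, mul_eq_zero, or_iff_right (Complex.exp_ne_zero _)]

theorem xcoeff_ext {s s' : InfSeries} (h : ∀ r, s.xcoeff r = s'.xcoeff r) : s = s' := by
  ext r
  have := h (-r)
  rwa [xcoeff, xcoeff, neg_neg] at this

/-- A Puiseux series with exponents below a bound has finitely many exponents above any other. -/
theorem IsPuiseux.finite_exponents {s : InfSeries} (hs : s.IsPuiseux) {b : ℚ}
    (hb : ∀ r, s.xcoeff r ≠ 0 → r < b) (a : ℚ) : {r | a ≤ r ∧ s.xcoeff r ≠ 0}.Finite := by
  obtain ⟨n, hn, h⟩ := hs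
  have hn' : (0 : ℚ) < n := by exact_mod_cast hn
  refine ((Set.finite_Icc ⌊n * a⌋ ⌈n * b⌉).image (fun m : ℤ => (m : ℚ) / n)).subset ?_
  rintro r ⟨har, hr⟩
  obtain ⟨m, hm⟩ := h r hr
  refine ⟨m, ⟨?_, ?_⟩, ?_⟩
  · refine Int.floor_le_iff.2 ?_
    rw [← hm]
    have := mul_le_mul_of_nonneg_left har hn'.le
    linarith
  · refine Int.le_ceil_iff.2 ?_
    rw [← hm]
    have := mul_lt_mul_of_pos_left (hb r hr) hn'
    linarith
  · change (m : ℚ) / n = r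
    rw [← hm]; field_simp

end InfSeries

namespace MvPolynomial

open InfSeries SpliceVertex

variable {f : MvPolynomial (Fin 2) ℂ} {c : ℂ} {P : Option ℂ} {s s' : InfSeries} {r r' : ℚ}

theorem mem_puiseuxBall_self (hs : s ∈ f.puiseuxAt c P) : s ∈ f.puiseuxBall c P s r :=
  ⟨hs, .refl _ _⟩

theorem puiseuxBall_eq_of_mem (h : s' ∈ f.puiseuxBall c P s r) :
    f.puiseuxBall c P s r = f.puiseuxBall c P s' r := by
  ext t
  exact and_congr_right fun _ => ⟨fun ht => h.2.symm.trans ht, fun ht => h.2.trans ht⟩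

theorem puiseuxBall_subset (h : r ≤ r') : f.puiseuxBall c P s r ⊆ f.puiseuxBall c P s r' :=
  fun _ ht => ⟨ht.1, ht.2.mono (Set.Ioi_subset_Ioi h)⟩

theorem mem_puiseuxBranch_self (hs : s ∈ f.puiseuxAt c P) : s ∈ f.puiseuxBranch c P s :=
  ⟨hs, .refl _ _⟩

theorem puiseuxBranch_subset : f.puiseuxBranch c P s ⊆ f.puiseuxBall c P s r :=
  fun _ ht => ⟨ht.1, ht.2.mono (Set.subset_univ _)⟩

/-- A relevant exponent occurs in some expansion and is at least an exponent at which two given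
distinct expansions differ. There are finitely many expansions, and each has finitely many exponents
above a bound. -/
theorem finite_setOf_isRelevant (hf : 0 < f.totalDegree) (c : ℂ) (P : Option ℂ) :
    {r | ∃ s ∈ f.puiseuxAt c P, f.IsRelevant c P s r}.Finite := by
  have hS := finite_puiseuxAt hf c P
  have key : ∀ t ∈ f.puiseuxAt c P, ∀ s s' : InfSeries, s' ≠ s →
      {r | t.xcoeff r ≠ 0 ∧ ∀ r' > r, s'.xcoeff r' = s.xcoeff r'}.Finite := by
    intro t ht s s' hne
    obtain ⟨a, ha⟩ : ∃ a, s'.xcoeff a ≠ s.xcoeff a := by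
      by_contra! h
      exact hne (xcoeff_ext h)
    refine (ht.1.finite_exponents ht.2.1 a).subset fun r hr => ⟨?_, hr.1⟩
    by_contra! h
    exact ha (hr.2 a h)
  refine ((hS.prod (hS.prod hS)).biUnion (t := fun x => {r | x.2.2 ≠ x.2.1 ∧
    x.1.xcoeff r ≠ 0 ∧ ∀ r' > r, x.2.2.xcoeff r' = x.2.1.xcoeff r'}) ?_).subset ?_
  · rintro ⟨t, s, s'⟩ ⟨ht, -⟩
    by_cases h : s' = s
    · convert Set.finite_empty
      ext r
      simp [h]
    · exact (key t ht s s' h).subset fun r hr => hr.2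
  · rintro r ⟨s, hs, ⟨s', hs', hne, h1⟩, ⟨t, ht, ht0, -⟩⟩
    rw [Set.mem_iUnion₂]
    exact ⟨(t, s, s'), ⟨ht, hs, hs'⟩, hne, ht0, h1⟩

end MvPolynomial

/-! ### The diagram of a fibre as a splice tree -/

namespace SpliceVertex

open MvPolynomial InfSeries

theorem not_above_self (u : SpliceVertex) : ¬ Above u u := by
  cases u <;> simp [Above]

theorem Above.trans {u v w : SpliceVertex} (huv : Above u v) (hvw : Above v w) : Above u w := by
  rcases u with _ | ⟨P, r, B⟩ | ⟨P, r, B⟩ | ⟨P, B⟩ <;>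
  rcases v with _ | ⟨P', r', B'⟩ | ⟨P', r', B'⟩ | ⟨P', B'⟩ <;>
  rcases w with _ | ⟨P'', r'', B''⟩ | ⟨P'', r'', B''⟩ | ⟨P'', B''⟩ <;>
  simp only [Above] at huv hvw ⊢
  · exact ⟨huv.1.trans hvw.1, hvw.2.1.trans huv.2.1, hvw.2.2.trans huv.2.2⟩
  · exact ⟨huv.1.trans hvw.1, (hvw.2.1.trans_lt huv.2.1).le, hvw.2.2.trans huv.2.2⟩
  · exact ⟨huv.1.trans hvw.1, hvw.2.trans huv.2.2⟩

theorem Above.eq_root_or_eq_node {u v : SpliceVertex} (h : Above u v) :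
    u = root ∨ ∃ P r B, u = node P r B := by
  rcases u with _ | ⟨P, r, B⟩ | ⟨P, r, B⟩ | ⟨P, B⟩
  · exact Or.inl rfl
  · exact Or.inr ⟨P, r, B, rfl⟩
  · exact h.elim
  · exact h.elim

variable {f : MvPolynomial (Fin 2) ℂ} {c : ℂ}

/-- The nodes above a vertex are named by the initial segments of a single expansion. -/
theorem IsVertex.exists_mem {w : SpliceVertex} (hw : w.IsVertex f c) (hroot : w ≠ root) :
    ∃ P, ∃ s ∈ f.puiseuxAt c P, ∀ u : SpliceVertex, u.IsVertex f c → Above u w → u = root ∨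
      ∃ r, u = node P r (f.puiseuxBall c P s r) ∧
        ∃ t ∈ f.puiseuxAt c P, f.IsRelevant c P t r := by
  obtain ⟨P, s, hs, h⟩ : ∃ P, ∃ s ∈ f.puiseuxAt c P, ∀ P' r B, Above (node P' r B) w →
      P' = P ∧ s ∈ B := by
    rcases w with _ | ⟨P, r, B⟩ | ⟨P, r, B⟩ | ⟨P, B⟩
    · exact absurd rfl hroot
    · obtain ⟨s, hs, -, rfl⟩ := hw
      exact ⟨P, s, hs, fun P' r' B' h => ⟨h.1, h.2.2 (mem_puiseuxBall_self hs)⟩⟩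
    · obtain ⟨⟨s, hs, -, rfl⟩, -⟩ := hw
      exact ⟨P, s, hs, fun P' r' B' h => ⟨h.1, h.2.2 (mem_puiseuxBall_self hs)⟩⟩
    · obtain ⟨s, hs, rfl⟩ := hw
      exact ⟨P, s, hs, fun P' r' B' h => ⟨h.1, h.2 (mem_puiseuxBranch_self hs)⟩⟩
  refine ⟨P, s, hs, fun u hu huw => ?_⟩
  rcases huw.eq_root_or_eq_node with rfl | ⟨P', r, B, rfl⟩
  · exact Or.inl rfl
  · obtain ⟨rfl, hsB⟩ := h P' r B huw
    obtain ⟨t, ht, hrel, rfl⟩ := hu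
    exact Or.inr ⟨r, by rw [puiseuxBall_eq_of_mem hsB], t, ht, hrel⟩

/-- The nodes above a vertex are the balls around one expansion, ordered by their exponents, so they
form a chain. It is finite because the relevant exponents are. -/
theorem isTreeOrder_above (hf : 0 < f.totalDegree) (c : ℂ) :
    IsTreeOrder (fun u v : {v : SpliceVertex // v.IsVertex f c} => Above u.1 v.1)
      ⟨root, trivial⟩ where
  irrefl u := not_above_self _
  trans h1 h2 := h1.trans h2
  root_lt {u} hu := by
    obtain ⟨u, hu'⟩ := u
    cases u
    · exact absurd rfl hu
    all_goals exact trivial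
  chain {u v w} hu hv := by
    have hw : w.1 ≠ root := by
      intro h
      rw [h] at hu
      rcases hu.eq_root_or_eq_node with h' | ⟨P, r, B, h'⟩ <;> rw [h'] at hu <;> exact hu
    obtain ⟨P, s, hs, h⟩ := w.2.exists_mem hw
    obtain ⟨u, hu'⟩ := u
    obtain ⟨v, hv'⟩ := v
    rcases h u hu' hu with rfl | ⟨r, rfl, -⟩ <;> rcases h v hv' hv with rfl | ⟨r', rfl, -⟩
    · exact Or.inl rfl
    · exact Or.inr (Or.inl trivial)
    · exact Or.inr (Or.inr trivial)
    · rcases lt_trichotomy r r' with h1 | rfl | h1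
      · exact Or.inr (Or.inr ⟨rfl, h1, puiseuxBall_subset h1.le⟩)
      · exact Or.inl rfl
      · exact Or.inr (Or.inl ⟨rfl, h1, puiseuxBall_subset h1.le⟩)
  finite w := by
    by_cases hw : w.1 = root
    · convert Set.finite_empty
      ext u
      refine iff_of_false (fun hu : Above u.1 w.1 => ?_) (by simp)
      rw [hw] at hu
      rcases hu.eq_root_or_eq_node with h' | ⟨P, r, B, h'⟩ <;> rw [h'] at hu <;> exact hu
    · obtain ⟨P, s, hs, h⟩ := w.2.exists_mem hw
      have hfin := ((finite_setOf_isRelevant hf c P).image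
        (fun r => node P r (f.puiseuxBall c P s r))).insert root
      refine (hfin.preimage Subtype.val_injective.injOn).subset fun u hu => ?_
      rcases h u.1 u.2 hu with h1 | ⟨r, h1, h2⟩
      · exact Or.inl h1
      · exact Or.inr ⟨r, h2, h1.symm⟩

/-- The expansions at a node of exponent `r' < r` are conjugate above `r'`, so their coefficients at
`r` all vanish or none does. Passing to a vertex farther out does not change which case holds. -/
theorem weight_eq_of_above {u v w : SpliceVertex} (hv : v.IsVertex f c) (hw : w.IsVertex f c)
    (huv : Above u v) (hvw : Above v w) : weight u v = weight u w := by
  rcases huv.eq_root_or_eq_node with rfl | ⟨P, r, B, rfl⟩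
  · rfl
  rcases hvw.eq_root_or_eq_node with rfl | ⟨P', r', B', rfl⟩
  · exact huv.elim
  have h1 : ¬ Above (node P' r' B') (node P r B) := fun h => not_above_self _ (h.trans huv)
  have h2 : ¬ Above w (node P r B) := fun h => not_above_self _ (h.trans (huv.trans hvw))
  have hlt : r' < r := huv.2.1
  obtain ⟨t, ht, -, rfl⟩ := hv
  have key : ∀ C : Set InfSeries, C.Nonempty → C ⊆ f.puiseuxBall c P' t r' →
      ((∀ s ∈ f.puiseuxBall c P' t r', s.xcoeff r = 0) ↔ ∀ s ∈ C, s.xcoeff r = 0) := by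
    rintro C ⟨x, hx⟩ hC
    refine ⟨fun h s hs => h s (hC hs), fun h s hs => ?_⟩
    exact (((hC hx).2.symm.trans hs.2).xcoeff_eq_zero_iff hlt).2 (h x hx)
  have h3 : InZeroDirection r (node P' r' (f.puiseuxBall c P' t r')) ↔ InZeroDirection r w := by
    rcases w with _ | ⟨P'', r'', B''⟩ | ⟨P'', r'', B''⟩ | ⟨P'', B''⟩
    · exact hvw.elim
    · obtain ⟨s, hs, -, rfl⟩ := hw
      exact key _ ⟨s, mem_puiseuxBall_self hs⟩ hvw.2.2
    · obtain ⟨⟨s, hs, -, rfl⟩, -⟩ := hw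
      refine (key _ ⟨s, mem_puiseuxBall_self hs⟩ hvw.2.2).trans (or_iff_right ?_).symm
      have : r'' ≤ r' := hvw.2.1
      linarith
    · obtain ⟨s, hs, rfl⟩ := hw
      exact key _ ⟨s, mem_puiseuxBranch_self hs⟩ hvw.2
  simp only [weight, if_neg h1, if_neg h2]
  by_cases h : InZeroDirection r w
  · rw [if_pos h, if_pos (h3.2 h)]
  · rw [if_neg h, if_neg (mt h3.1 h)]

theorem weight_eq_of_above_of_above {u v w : SpliceVertex} (hwv : Above w v) (hvu : Above v u) :
    weight u v = weight u w := by
  rcases u with _ | ⟨P, r, B⟩ | ⟨P, r, B⟩ | ⟨P, B⟩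
  · rfl
  · simp only [weight, if_pos hvu, if_pos (hwv.trans hvu)]
  · rfl
  · rfl

theorem isSpliceTree (hf : 0 < f.totalDegree) (c : ℂ) :
    IsSpliceTree (fun u v : {v : SpliceVertex // v.IsVertex f c} => Above u.1 v.1)
      ⟨root, trivial⟩ (fun v => ∃ P B, v.1 = arrow P B) (fun u v => weight u.1 v.1)
      (fun n l => ∃ P r B, n.1 = node P r B ∧ l.1 = leaf P r B) where
  order := isTreeOrder_above hf c
  not_arrow_root := by rintro ⟨P, B, h⟩; cases h
  weight_root _ := rfl
  weight_down {_ v w} h1 h2 := weight_eq_of_above v.2 w.2 h1 h2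
  weight_up h1 h2 := weight_eq_of_above_of_above h1 h2
  tip_covers := by
    rintro ⟨_, hn⟩ ⟨_, hl⟩ ⟨P, r, B, rfl, rfl⟩
    refine ⟨⟨rfl, le_rfl, le_rfl⟩, ?_⟩
    rintro ⟨w, hw⟩ ⟨h1, h2⟩
    rcases h2.eq_root_or_eq_node with rfl | ⟨P', r', B', rfl⟩
    · exact h1
    · exact absurd h1.2.1 (not_lt.2 h2.2.1)
  tip_maximal := by
    rintro ⟨_, hn⟩ ⟨_, hl⟩ ⟨P, r, B, rfl, rfl⟩ z h
    exact h
  tip_not_arrow := by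
    rintro ⟨_, hn⟩ ⟨_, hl⟩ ⟨P, r, B, rfl, rfl⟩ ⟨P', B', h⟩
    cases h
  tip_ne_root := by
    rintro ⟨_, hn⟩ ⟨_, hl⟩ ⟨P, r, B, rfl, rfl⟩ h
    cases congrArg Subtype.val h
  exists_arrow := by
    rintro ⟨_, hn⟩ ⟨_, hl⟩ ⟨P, r, B, rfl, rfl⟩
    obtain ⟨s, hs, -, rfl⟩ := hn
    exact ⟨⟨arrow P (f.puiseuxBranch c P s), s, hs, rfl⟩, ⟨_, _, rfl⟩, rfl, puiseuxBranch_subset⟩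

end SpliceVertex

namespace MvPolynomial

open SpliceVertex

theorem isPruning_fibreDiagram (f : MvPolynomial (Fin 2) ℂ) (c : ℂ) :
    SpliceDiagram.IsPruning (fun u v : {v : SpliceVertex // v.IsVertex f c} => Above u.1 v.1)
      ⟨root, trivial⟩ (fun v => ∃ P B, v.1 = arrow P B) (fun u v => weight u.1 v.1)
      (fun n l => ∃ P r B, n.1 = node P r B ∧ l.1 = leaf P r B) (f.fibreDiagram c) id where
  injective := Function.injective_id
  exists_root := ⟨_, rfl⟩
  exists_arrow a _ := ⟨a, rfl⟩
  exists_tip n l _ _ := ⟨⟨n, rfl⟩, ⟨l, rfl⟩⟩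
  adj_iff u v := by
    refine (SimpleGraph.fromRel_adj _ u v).trans ?_
    have key : ∀ u v : {v : SpliceVertex // v.IsVertex f c}, (Above u.1 v.1 ∧
        ∀ w : SpliceVertex, w.IsVertex f c → ¬ (Above u.1 w ∧ Above w v.1)) ↔
        RelCovers (fun u v : {v : SpliceVertex // v.IsVertex f c} => Above u.1 v.1) u v :=
      fun u v => and_congr_right fun _ => ⟨fun h w => h w.1 w.2, fun h w hw => h ⟨w, hw⟩⟩
    refine Iff.trans ?_ (or_congr (key u v) (key v u))
    refine and_iff_right_of_imp fun h he => ?_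
    rcases h with h | h
    · exact not_above_self _ (he ▸ h.1)
    · exact not_above_self _ (he ▸ h.1)
  isArrow_iff _ := Iff.rfl
  isRoot_iff v := ⟨fun h => Subtype.ext h, fun h => congrArg Subtype.val h⟩
  weight_eq _ _ _ := rfl

end MvPolynomial

/-! ### The sign of the Newton weights -/

/-- Decreasing exponents make every `dᵢ` nonpositive, so `qᵢ₊₁ = dᵢ + qᵢ pᵢ pᵢ₊₁` inherits the sign
of `qᵢ`. -/
theorem newtonRec_fst_nonpos (l : List ℚ) : ∀ (r : ℚ) (M : ℕ) (q : ℤ) (p : ℕ), q ≤ 0 →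
    (r :: l).Pairwise (fun a b => b ≤ a) → (newtonRec r M q p l).1 ≤ 0 := by
  induction l with
  | nil => intro r M q p hq _; exact hq
  | cons r' l ih =>
    intro r M q p hq hl
    rw [List.pairwise_cons] at hl
    refine ih _ _ _ _ ?_ hl.2
    have h1 : r' - r ≤ 0 := sub_nonpos.2 (hl.1 r' List.mem_cons_self)
    have h2 : ((r' - r) * M * (((M : ℚ) * r').den : ℕ)).num ≤ 0 := by
      rw [Rat.num_nonpos]
      exact mul_nonpos_of_nonpos_of_nonneg
        (mul_nonpos_of_nonpos_of_nonneg h1 (Nat.cast_nonneg _)) (Nat.cast_nonneg _)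
    have h3 : q * p * (((M : ℚ) * r').den : ℕ) ≤ 0 :=
      mul_nonpos_of_nonpos_of_nonneg (mul_nonpos_of_nonpos_of_nonneg hq (Int.natCast_nonneg _))
        (Int.natCast_nonneg _)
    exact add_nonpos h2 h3

theorem newtonWeights_singleton (r : ℚ) : newtonWeights [r] = (r.num, r.den) := by
  simp [newtonWeights, newtonRec, Rat.mul_den_eq_num]

namespace InfSeries

theorem exponentsAbove_eq_nil {s : InfSeries} {r : ℚ} (h : ∀ r' > r, s.xcoeff r' = 0) :
    s.exponentsAbove r = [] := by
  have he : {r' : ℚ | r < r' ∧ s.xcoeff r' ≠ 0} = ∅ := by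
    ext r'
    refine iff_of_false (fun hr => hr.2 (h r' hr.1)) (by simp)
  rw [exponentsAbove]
  split_ifs with hfin
  · have : hfin.toFinset = ∅ := by
      rw [Set.Finite.toFinset_eq_empty]; exact he
    rw [this, Finset.sort_empty]
  · rfl

theorem newtonWeights_exponentsAbove_nonpos {s : InfSeries} {r : ℚ} (hr : r ≤ 0)
    (h : ∀ r', s.xcoeff r' ≠ 0 → r' ≤ 0) :
    (newtonWeights (s.exponentsAbove r ++ [r])).1 ≤ 0 := by
  apply newtonRec_fst_nonpos _ _ _ _ _ le_rfl
  have hmem : ∀ x ∈ s.exponentsAbove r, r < x ∧ s.xcoeff x ≠ 0 := by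
    intro x hx
    rw [exponentsAbove] at hx
    split_ifs at hx with hfin
    · rw [Finset.mem_sort, Set.Finite.mem_toFinset] at hx
      exact hx
    · simp at hx
  have hsort : (s.exponentsAbove r).Pairwise (fun a b => b ≤ a) := by
    rw [exponentsAbove]
    split_ifs with hfin
    · exact Finset.pairwise_sort _ _
    · exact List.Pairwise.nil
  rw [List.pairwise_cons, List.pairwise_append]
  refine ⟨fun x hx => ?_, hsort, List.pairwise_singleton _ _, fun a ha b hb => ?_⟩
  · rw [List.mem_append, List.mem_singleton] at hx
    rcases hx with hx | rfl
    · exact h x (hmem x hx).2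
    · exact hr
  · rw [List.mem_singleton] at hb
    exact hb ▸ (hmem a ha).1.le

end InfSeries

/-! ### Proof of the proposition -/

open SpliceVertex InfSeries in
theorem mainTheorem1 (f : MvPolynomial (Fin 2) ℂ) (hf : 0 < f.totalDegree)
    (hpos : f.IsPointAtInfinity 1 0) (D : SpliceDiagram)
    (hD : f.IsRegularRootedSpliceDiagram D) (hmin : ¬ D.IsMinimal) :
    ∃ (c : ℂ) (q : ℕ), 1 < q ∧
      (MvPolynomial.triangularAut c q f).totalDegree < f.totalDegree := by
  obtain ⟨c, hc⟩ := hD.exists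
  obtain ⟨⟨n, hn⟩, hnroot, hnarrow, ⟨z, hz⟩, harrow, hweight, htip⟩ :=
    (MvPolynomial.isPruning_fibreDiagram f c).exists_of_not_isMinimal (isSpliceTree hf c) hc hmin
  obtain ⟨P, r, B, rfl⟩ : ∃ P r B, n = node P r B :=
    (Above.eq_root_or_eq_node hz).resolve_left fun h => hnroot (Subtype.ext h)
  have hall : ∀ P' s, s ∈ f.puiseuxAt c P' → P = P' ∧ s ∈ B := by
    intro P' s hs
    have h : Above (node P r B) (arrow P' (f.puiseuxBranch c P' s)) :=
      harrow ⟨arrow P' (f.puiseuxBranch c P' s), s, hs, rfl⟩ ⟨_, _, rfl⟩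
    exact ⟨h.1, h.2 (MvPolynomial.mem_puiseuxBranch_self hs)⟩
  -- Since `[1 : 0]` is at infinity, there is an expansion at it; the node above all arrowheads
  -- therefore belongs to this point.
  obtain ⟨s₁, hs₁⟩ := MvPolynomial.puiseuxAt_some_nonempty hf (hpos.isRoot_edgePolynomial hf c)
  obtain rfl : P = some 0 := (hall _ _ hs₁).1
  obtain ⟨s₀, hs₀, hrel, hB⟩ := hn
  replace hweight : rootWeight r B = 1 := by
    rw [← hweight]
    exact (if_pos trivial).symm
  have heps : (Classical.epsilon fun s => s ∈ B) ∈ B :=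
    Classical.epsilon_spec (p := fun s => s ∈ B) ⟨s₁, (hall _ _ hs₁).2⟩
  -- The representative from which the weights of the node are computed; all expansions are
  -- conjugate to it above `r`.
  obtain ⟨s, hs⟩ : ∃ s, s = Classical.epsilon fun s => s ∈ B := ⟨_, rfl⟩
  rw [rootWeight, ← hs] at hweight
  rw [← hs, hB] at heps
  have hconj : ∀ t ∈ f.puiseuxAt c (some 0), ConjOn (Set.Ioi r) s t := fun t ht =>
    heps.2.symm.trans (hB ▸ (hall _ t ht).2 : t ∈ f.puiseuxBall c (some 0) s₀ r).2
  obtain ⟨t, ht, ht0, -⟩ := hrel.2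
  have hr1 : r < 1 := ht.2.1 r ht0
  have htop : ∀ r' > r, s.xcoeff r' = 0 := by
    by_contra! hcon
    obtain ⟨r', hr', hr'0⟩ := hcon
    have hs0 : s ≠ 0 := by rintro rfl; exact hr'0 rfl
    obtain ⟨r₀, hr₀⟩ : ∃ r₀, r₀ = -s.order := ⟨_, rfl⟩
    have hr₀0 : s.xcoeff r₀ ≠ 0 := by
      rw [xcoeff, hr₀, neg_neg]; exact HahnSeries.coeff_order_eq_zero.not.2 hs0
    have hr₀le : ∀ a, s.xcoeff a ≠ 0 → a ≤ r₀ := by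
      intro a ha
      have := HahnSeries.order_le_of_coeff_ne_zero ha
      linarith
    have hrr₀ : r < r₀ := lt_of_lt_of_le hr' (hr₀le r' hr'0)
    have habove : ∀ t ∈ f.puiseuxAt c (some 0), ∀ a > r₀, t.xcoeff a = 0 := by
      intro t ht a ha
      rw [(hconj t ht).xcoeff_eq_zero_iff (hrr₀.trans ha)]
      by_contra h
      exact absurd (hr₀le a h) (not_le.2 ha)
    -- Relevance of the node supplies two distinct expansions, and at least one of them is not `s`.
    obtain ⟨s₂, hs₂, hne⟩ : ∃ s₂ ∈ f.puiseuxAt c (some 0), s₂ ≠ s := by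
      obtain ⟨s₂, hs₂, hne, -⟩ := hrel.1
      by_cases h : s₂ = s
      · exact ⟨s₀, hs₀, fun h' => hne (h.trans h'.symm)⟩
      · exact ⟨s₂, hs₂, h⟩
    have hrel₀ : f.IsRelevant c (some 0) s r₀ :=
      ⟨⟨s₂, hs₂, hne, fun a ha => by rw [habove _ hs₂ a ha, habove _ heps.1 a ha]⟩,
        s, heps.1, hr₀0, fun _ _ => rfl⟩
    -- By conjugacy every expansion has a non-zero term at the leading exponent `r₀`, so the node
    -- there carries an extra leaf. Its weight `r₀.den` must be `1`.
    have hw := htip ⟨node (some 0) r₀ (f.puiseuxBall c (some 0) s r₀), s, heps.1, hrel₀, rfl⟩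
      ⟨leaf (some 0) r₀ (f.puiseuxBall c (some 0) s r₀), ⟨s, heps.1, hrel₀, rfl⟩,
        fun t ht h0 => hr₀0 (((hconj t ht.1).xcoeff_eq_zero_iff hrr₀).1 h0)⟩
      ⟨_, _, _, rfl, rfl⟩ ⟨rfl, hrr₀, fun t ht => by
        rw [hB] at ht
        exact ⟨ht.1, (hconj t ht.1).mono (Set.Ioi_subset_Ioi hrr₀.le)⟩⟩
    replace hw : zeroWeight r₀ (f.puiseuxBall c (some 0) s r₀) = 1 := by
      rw [← hw]
      refine ((if_neg ?_).trans (if_pos ?_)).symm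
      · exact id
      · exact Or.inl rfl
    have heps₀ := Classical.epsilon_spec (p := fun t => t ∈ f.puiseuxBall c (some 0) s r₀)
      ⟨s, MvPolynomial.mem_puiseuxBall_self heps.1⟩
    rw [zeroWeight, exponentsAbove_eq_nil (habove _ heps₀.1), List.nil_append,
      newtonWeights_singleton] at hw
    have hden : r₀.den = 1 := by exact_mod_cast hw
    have hr₀1 : r₀ < 1 := heps.1.2.1 _ hr₀0
    have hr₀' : r₀ ≤ 0 := by
      rw [← Rat.coe_int_num_of_den_eq_one hden] at hr₀1 ⊢
      have : r₀.num < 1 := by exact_mod_cast hr₀1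
      exact_mod_cast (by omega : r₀.num ≤ 0)
    -- All exponents of `s` are nonpositive, so the weight of the node towards the root is too,
    -- while `hweight` says that it is `1`.
    have := newtonWeights_exponentsAbove_nonpos (s := s) (hrr₀.le.trans hr₀')
      fun a ha => (hr₀le a ha).trans hr₀'
    omega
  rw [exponentsAbove_eq_nil htop, List.nil_append, newtonWeights_singleton] at hweight
  have hr : r = 1 / (r.den : ℚ) := by
    have h := Rat.num_div_den r
    rw [show r.num = 1 from hweight, Int.cast_one] at h
    exact h.symm
  have hp : 1 < r.den := by
    have h0 := r.den_pos
    by_contra hle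
    have h1 : r.den = 1 := by omega
    rw [hr, h1] at hr1
    norm_num at hr1
  obtain ⟨c', hc'⟩ := MvPolynomial.exists_totalDegree_triangularAut_lt hf c hp
    (fun P ⟨s, hs⟩ => (hall P s hs).1.symm)
    (fun t ht a ha => by
      rw [← hr] at ha
      exact ((hconj t ht).xcoeff_eq_zero_iff ha).2 (htop a ha))
    ⟨t, ht, by rwa [← hr]⟩
  exact ⟨c', r.den, hp, hc'⟩
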